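/- A chord diagram of size $n$ is a partition of $2n$ points on a circle, labelled $1,\dots,2n$ in clockwise order, into $n$ pairs (chords). Chords $\{a,b\}$ and $\{c,d\}$ with $a<b$, $c<d$ cross if $a<c<b<d$ or $c<a<d<b$. The intersection graph of a diagram has the chords as its vertices, with two chords adjacent when they cross; the components of the diagram are the connected components of this graph. The size of a component is its number of chords, and its (crossing, or edge) density is the number of crossings between its chords divided by its number of chords. Let $\alpha>4e^2$ be a constant and $\beta=\dfrac{5}{\log\alpha-\log(4e^2)}$. Let $m=m(n)$ be a sequence of nonnegative integers such that, for all sufficiently large $n$, \[ \frac{m}{n}>\alpha\qquad\text{and}\qquad m\le\frac{2}{\pi^2}\,n\Bigl(\log n-\tfrac32\log\log n-\omega(n)\Bigr), \] where $\omega(n)\to\infty$ arbitrarily slowly. Choose a chord diagram uniformly at random among all chord diagrams of size $n$ with exactly $m$ crossings. Then, with probability tending to $1$ as $n\to\infty$, the diagram has no component of size greater than $\beta\log n$ whose density is less than $\dfrac{m}{\alpha n}$. -/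

import Mathlib

open Filter Topology

/-- A chord diagram of size `n`: a pairing of `2n` points, labelled `0, …, 2n - 1` in cyclic order,
given by the fixed-point-free involution that sends each point to its partner. -/
@[ext]
structure ChordDiagram (n : ℕ) where
  partner : Fin (2 * n) → Fin (2 * n)
  involutive : Function.Involutive partner
  partner_ne : ∀ i, partner i ≠ i

namespace ChordDiagram

variable {n : ℕ}

instance : Finite (ChordDiagram n) :=
  Finite.of_injective (fun D : ChordDiagram n => D.partner) fun _ _ h => ChordDiagram.ext h

/-- A chord of `D`, written as the pair of its endpoints, the smaller one first. -/
def Chord (D : ChordDiagram n) : Type :=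
  {p : Fin (2 * n) × Fin (2 * n) // p.1 < p.2 ∧ D.partner p.1 = p.2}

instance (D : ChordDiagram n) : Finite D.Chord :=
  inferInstanceAs (Finite {p : Fin (2 * n) × Fin (2 * n) // p.1 < p.2 ∧ D.partner p.1 = p.2})

/-- The endpoints of `c` and `d` interleave as `c₁ < d₁ < c₂ < d₂`. -/
def Interleave {D : ChordDiagram n} (c d : D.Chord) : Prop :=
  c.1.1 < d.1.1 ∧ d.1.1 < c.1.2 ∧ c.1.2 < d.1.2

/-- The intersection graph: vertices are the chords, and two chords are adjacent when they cross. -/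
def intersectionGraph (D : ChordDiagram n) : SimpleGraph D.Chord where
  Adj c d := Interleave c d ∨ Interleave d c
  symm := ⟨fun _ _ h => h.symm⟩
  loopless := ⟨fun _ h => h.elim (fun h => lt_irrefl _ h.1) (fun h => lt_irrefl _ h.1)⟩

/-- The number of crossings of `D`, i.e. of edges of its intersection graph. -/
noncomputable def crossings (D : ChordDiagram n) : ℕ :=
  D.intersectionGraph.edgeSet.ncard

/-- The number of chords of a component. -/
noncomputable def componentSize (D : ChordDiagram n)
    (K : D.intersectionGraph.ConnectedComponent) : ℕ :=
  K.supp.ncard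

/-- The number of crossings between chords of a component. -/
noncomputable def componentCrossings (D : ChordDiagram n)
    (K : D.intersectionGraph.ConnectedComponent) : ℕ :=
  (D.intersectionGraph.induce K.supp).edgeSet.ncard

/-- The crossing density (edge density) of a component: crossings divided by chords. -/
noncomputable def componentDensity (D : ChordDiagram n)
    (K : D.intersectionGraph.ConnectedComponent) : ℝ :=
  (D.componentCrossings K : ℝ) / (D.componentSize K : ℝ)

/-- The probability of `P` for a diagram chosen uniformly at random among the chord diagrams of
size `n` with exactly `m` crossings (`0` when there are none). -/
noncomputable def uniformProb (n m : ℕ) (P : ChordDiagram n → Prop) : ℝ :=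
  (Nat.card {D : ChordDiagram n // D.crossings = m ∧ P D} : ℝ) /
    (Nat.card {D : ChordDiagram n // D.crossings = m} : ℝ)

end ChordDiagram

/-! The proof is a first-moment count: an upper bound for the diagrams with a large sparse component
is divided by a lower bound for all diagrams with `m` crossings.

A diagram is encoded by its set of `n` closing points and, at each of them, a label: how many chords
opened after the closing chord are still open. The labels sum to the number of crossings, and
closers and labels determine the diagram (`eq_of_closers_eq_of_label_eq`).

Upper bound (`card_component_le`): a component with `k` chords and `l` crossings splits the labels
into `k` numbers with sum `l` and `n - k` numbers with sum `m - l`. Its point set `S` and the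
closers `C` leave only `(2n+1) * 4^n * 4^k` choices, because no outside chord separates two points
of `S`, and so `S` can be recovered from its first point, its size and `S ∪ C`
(`points_eq_of_union_eq`). Summing over `l ≤ k * m / (αn)` bounds the label count by `n.multichoose
m` times a power with exponent `k`; with the factor `4^k` the total weight is at most `r^k *
n.multichoose m`, where `r = 4e²/α < 1` (`sum_component_bound`). For `k > β log n` the geometric
tail is `O(n^(-5))`.

Lower bound (`le_card_crossings`): diagrams dominate Dyck paths in which a down-step from height `h`
has weight `1 + q + ... + q^(h-1)`, with `q` marking crossings. Only paths are kept that climb from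
`0` to `H` in `t` steps, stay above `H` for `2(n-t)` steps and descend in `t` steps. The middle
gives a Catalan number times coefficients of `[H+1]^(n-t)`, which near the saddle point `q =
m/(m+n)` are within a constant of `n.multichoose m * q^j * (1-q)^t`. The ends then become path sums
evaluated at `q`, with weights `1 - q^h`. The continuous q-Hermite polynomials at `1` form a
harmonic function for these weights, and stopping at height `H` yields some short `t` with a large
path sum (`exists_transfer_ge`). The loss is essentially the cube of `(q;q)_H`, and `(q;q)_H ≥
exp(-(m/n) * π²/6)`; the constant `2/π²` in the bound on `m` makes this loss at most a factor `n`.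

Altogether there are at least `n.multichoose m * 4^n / n^(7/2)` diagrams and `O(n.multichoose m *
4^n / n^4)` bad ones, so the bad proportion is `O(1/√n)`. -/

open Classical in
/-- The number of edges of a graph whose adjacency is the symmetrization of an asymmetric relation
is the number of related pairs. -/
theorem SimpleGraph.ncard_edgeSet_of_asymm {V : Type*} [Finite V] (G : SimpleGraph V)
    (r : V → V → Prop) (hadj : ∀ a b, G.Adj a b ↔ r a b ∨ r b a)
    (hasymm : ∀ a b, r a b → ¬ r b a) :
    G.edgeSet.ncard = Nat.card {p : V × V // r p.1 p.2} := by
  rw [← Nat.card_coe_set_eq]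
  symm
  refine Nat.card_congr (Equiv.ofBijective
    (fun p => ⟨s(p.1.1, p.1.2), (hadj _ _).2 (Or.inl p.2)⟩) ⟨?_, ?_⟩)
  · rintro ⟨⟨a, b⟩, h⟩ ⟨⟨c, d⟩, h'⟩ he
    have he' : s(a, b) = s(c, d) := congrArg Subtype.val he
    rcases Sym2.eq_iff.1 he' with ⟨rfl, rfl⟩ | ⟨rfl, rfl⟩
    · rfl
    · exact absurd h' (hasymm _ _ h)
  · rintro ⟨e, he⟩
    induction e with
    | _ a b =>
      rcases (hadj a b).1 he with h | h
      · exact ⟨⟨(a, b), h⟩, rfl⟩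
      · exact ⟨⟨(b, a), h⟩, by simp [Sym2.eq_swap]⟩

/-! ### Encoding a diagram by closing points and labels -/

namespace ChordDiagram

variable {n : ℕ}

theorem partner_partner (D : ChordDiagram n) (i : Fin (2 * n)) : D.partner (D.partner i) = i :=
  D.involutive i

/-- The endpoints of chords that come second. -/
def closers (D : ChordDiagram n) : Finset (Fin (2 * n)) :=
  Finset.univ.filter fun i => D.partner i < i

@[simp]
theorem mem_closers (D : ChordDiagram n) (i : Fin (2 * n)) : i ∈ D.closers ↔ D.partner i < i := by
  simp [closers]

/-- The number of chords opened inside the chord closing at `i` and closed after `i`. -/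
def label (D : ChordDiagram n) (i : Fin (2 * n)) : ℕ :=
  (Finset.univ.filter fun x => D.partner i < x ∧ x < i ∧ i < D.partner x).card

theorem label_eq_zero (D : ChordDiagram n) {i : Fin (2 * n)} (h : i < D.partner i) :
    D.label i = 0 := by
  rw [label, Finset.card_eq_zero, Finset.filter_eq_empty_iff]
  rintro x - ⟨h1, h2, -⟩
  exact absurd (h.trans (h1.trans h2)) (lt_irrefl _)

theorem partner_lt_or_gt (D : ChordDiagram n) (i : Fin (2 * n)) :
    D.partner i < i ∨ i < D.partner i := lt_or_gt_of_ne (D.partner_ne i)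

theorem Chord.snd_partner {D : ChordDiagram n} (c : D.Chord) : D.partner c.1.2 = c.1.1 := by
  rw [← c.2.2, D.partner_partner]

theorem Chord.ext {D : ChordDiagram n} {c d : D.Chord} (h : c.1.1 = d.1.1) : c = d :=
  Subtype.ext (Prod.ext h (by rw [← c.2.2, ← d.2.2, h]))

/-- The chord opening at the point `i`. -/
def chordOpeningAt (D : ChordDiagram n) (i : Fin (2 * n)) (h : i < D.partner i) : D.Chord :=
  ⟨(i, D.partner i), h, rfl⟩

/-- The chord closing at the point `i`. -/
def chordClosingAt (D : ChordDiagram n) (i : Fin (2 * n)) (h : D.partner i < i) : D.Chord :=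
  ⟨(D.partner i, i), h, D.partner_partner i⟩

/-- The chord through the point `i`. -/
def chordAt (D : ChordDiagram n) (i : Fin (2 * n)) : D.Chord :=
  if h : D.partner i < i then D.chordClosingAt i h
  else D.chordOpeningAt i (lt_of_le_of_ne (not_lt.1 h) (D.partner_ne i).symm)

theorem chordAt_of_partner_lt {D : ChordDiagram n} {i : Fin (2 * n)} (h : D.partner i < i) :
    D.chordAt i = D.chordClosingAt i h := by rw [chordAt, dif_pos h]

theorem chordAt_of_lt_partner {D : ChordDiagram n} {i : Fin (2 * n)} (h : i < D.partner i) :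
    D.chordAt i = D.chordOpeningAt i h := by rw [chordAt, dif_neg h.not_gt]

theorem chordAt_fst {D : ChordDiagram n} (c : D.Chord) : D.chordAt c.1.1 = c := by
  have h : c.1.1 < D.partner c.1.1 := by rw [c.2.2]; exact c.2.1
  rw [chordAt_of_lt_partner h]
  exact Chord.ext rfl

theorem chordAt_snd {D : ChordDiagram n} (c : D.Chord) : D.chordAt c.1.2 = c := by
  have h : D.partner c.1.2 < c.1.2 := by rw [c.snd_partner]; exact c.2.1
  rw [chordAt_of_partner_lt h]
  exact Chord.ext c.snd_partner

theorem chordAt_partner (D : ChordDiagram n) (i : Fin (2 * n)) :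
    D.chordAt (D.partner i) = D.chordAt i := by
  rcases D.partner_lt_or_gt i with h | h
  · rw [chordAt_of_partner_lt h]
    exact chordAt_fst (D.chordClosingAt i h)
  · rw [chordAt_of_lt_partner h]
    exact chordAt_snd (D.chordOpeningAt i h)

theorem Interleave.asymm {D : ChordDiagram n} {c d : D.Chord} (h : Interleave c d) :
    ¬ Interleave d c := fun h' => absurd (h.1.trans h'.1) (lt_irrefl _)

open Classical in
/-- The crossings inside a set of chords closed under crossing are counted by the labels. -/
theorem ncard_edgeSet_induce (D : ChordDiagram n) (U : Set D.Chord)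
    (hU : ∀ c ∈ U, ∀ d, Interleave c d → d ∈ U) :
    (D.intersectionGraph.induce U).edgeSet.ncard =
      ∑ i ∈ Finset.univ.filter (fun i => D.chordAt i ∈ U), D.label i := by
  rw [SimpleGraph.ncard_edgeSet_of_asymm _ (fun a b : U => Interleave a.1 b.1)
    (fun a b => Iff.rfl) (fun a b h => h.asymm)]
  simp only [label]
  have := Fintype.ofFinite {p : U × U // Interleave p.1.1 p.2.1}
  rw [← Finset.card_sigma, Nat.card_eq_fintype_card, ← Finset.card_univ]
  -- A crossing is recorded at the closing point of the chord that closes first, together with the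
  -- opening point of the other chord.
  refine Finset.card_bij (fun p _ => ⟨p.1.1.1.1.2, p.1.2.1.1.1⟩) ?_ ?_ ?_
  · rintro ⟨⟨⟨c, hc⟩, ⟨d, hd⟩⟩, h⟩ -
    simp only [Finset.mem_sigma, Finset.mem_filter, Finset.mem_univ, true_and, chordAt_snd, hc,
      c.snd_partner, d.2.2]
    exact h
  · rintro ⟨⟨⟨c, hc⟩, ⟨d, hd⟩⟩, h⟩ - ⟨⟨⟨c', hc'⟩, ⟨d', hd'⟩⟩, h'⟩ - he
    simp only [Sigma.mk.injEq, heq_eq_eq] at he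
    have h1 : c = c' := by rw [← chordAt_snd c, he.1, chordAt_snd]
    have h2 : d = d' := by rw [← chordAt_fst d, he.2, chordAt_fst]
    subst h1 h2
    rfl
  · rintro ⟨i, x⟩ h
    simp only [Finset.mem_sigma, Finset.mem_filter, Finset.mem_univ, true_and] at h
    obtain ⟨hi, h1, h2, h3⟩ := h
    have hi' : D.partner i < i := h1.trans h2
    have hx' : x < D.partner x := h2.trans h3
    have hI : Interleave (D.chordClosingAt i hi') (D.chordOpeningAt x hx') := ⟨h1, h2, h3⟩
    rw [chordAt_of_partner_lt hi'] at hi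
    exact ⟨⟨(⟨_, hi⟩, ⟨_, hU _ hi _ hI⟩), hI⟩, Finset.mem_univ _, rfl⟩

theorem crossings_eq_sum_label (D : ChordDiagram n) : D.crossings = ∑ i, D.label i := by
  have h := D.ncard_edgeSet_induce Set.univ (fun _ _ _ _ => trivial)
  simp only [Set.mem_univ, Finset.filter_true] at h
  rw [← h, crossings, ← Nat.card_coe_set_eq, ← Nat.card_coe_set_eq]
  exact (Nat.card_congr (SimpleGraph.induceUnivIso _).mapEdgeSet).symm

open Classical in
/-- The endpoints of the chords of a component. -/
noncomputable def points (D : ChordDiagram n) (K : D.intersectionGraph.ConnectedComponent) :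
    Finset (Fin (2 * n)) :=
  Finset.univ.filter fun i => D.chordAt i ∈ K.supp

@[simp]
theorem mem_points {D : ChordDiagram n} {K : D.intersectionGraph.ConnectedComponent}
    {i : Fin (2 * n)} : i ∈ D.points K ↔ D.chordAt i ∈ K.supp := by
  simp [points]

theorem partner_mem_points {D : ChordDiagram n} {K : D.intersectionGraph.ConnectedComponent}
    {i : Fin (2 * n)} : D.partner i ∈ D.points K ↔ i ∈ D.points K := by
  rw [mem_points, mem_points, chordAt_partner]

theorem componentCrossings_eq_sum_label (D : ChordDiagram n)
    (K : D.intersectionGraph.ConnectedComponent) :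
    D.componentCrossings K = ∑ i ∈ D.points K, D.label i := by
  classical
  rw [componentCrossings, ncard_edgeSet_induce, points]
  intro c hc d hcd
  exact K.mem_supp_of_adj_mem_supp hc (Or.inl hcd)

open Classical in
theorem card_points_inter_closers (D : ChordDiagram n)
    (K : D.intersectionGraph.ConnectedComponent) :
    (D.points K ∩ D.closers).card = D.componentSize K := by
  have := Fintype.ofFinite K.supp
  rw [componentSize, ← Nat.card_coe_set_eq, Nat.card_eq_fintype_card, ← Finset.card_univ]
  symm
  refine Finset.card_bij (fun c _ => c.1.1.2) ?_ ?_ ?_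
  · rintro ⟨c, hc⟩ -
    simp only [Finset.mem_inter, mem_points, chordAt_snd, mem_closers, c.snd_partner]
    exact ⟨hc, c.2.1⟩
  · rintro ⟨c, hc⟩ - ⟨d, hd⟩ - h
    have h1 : c = d := by rw [← chordAt_snd c, show c.1.2 = d.1.2 from h, chordAt_snd]
    exact Subtype.ext h1
  · intro i hi
    simp only [Finset.mem_inter, mem_points, mem_closers] at hi
    rw [chordAt_of_partner_lt hi.2] at hi
    exact ⟨⟨_, hi.1⟩, Finset.mem_univ _, rfl⟩

open Classical in
theorem card_sdiff_closers_of_partner_mem (D : ChordDiagram n) (S : Finset (Fin (2 * n)))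
    (hS : ∀ i ∈ S, D.partner i ∈ S) : (S \ D.closers).card = (S ∩ D.closers).card := by
  refine Finset.card_bij (fun i _ => D.partner i) ?_ ?_ ?_
  · intro i hi
    simp only [Finset.mem_sdiff, mem_closers, Finset.mem_inter, D.partner_partner] at hi ⊢
    exact ⟨hS _ hi.1, (D.partner_lt_or_gt i).resolve_left hi.2⟩
  · intro i _ j _ h
    exact D.involutive.injective h
  · intro i hi
    simp only [Finset.mem_inter, mem_closers] at hi
    refine ⟨D.partner i, ?_, D.partner_partner i⟩
    simp only [Finset.mem_sdiff, mem_closers, D.partner_partner]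
    exact ⟨hS _ hi.1, hi.2.not_gt⟩

theorem card_points (D : ChordDiagram n) (K : D.intersectionGraph.ConnectedComponent) :
    (D.points K).card = 2 * D.componentSize K := by
  classical
  rw [← Finset.card_inter_add_card_sdiff (D.points K) D.closers,
    D.card_sdiff_closers_of_partner_mem _ (fun i hi => partner_mem_points.2 hi),
    card_points_inter_closers]
  ring

theorem card_closers (D : ChordDiagram n) : D.closers.card = n := by
  classical
  have h := D.card_sdiff_closers_of_partner_mem Finset.univ (fun _ _ => Finset.mem_univ _)
  have h2 := Finset.card_inter_add_card_sdiff Finset.univ D.closers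
  rw [h, Finset.univ_inter, Finset.card_univ, Fintype.card_fin] at h2
  omega

/-- A diagram is determined by its closing points and its labels. -/
theorem eq_of_closers_eq_of_label_eq {D E : ChordDiagram n} (hC : D.closers = E.closers)
    (hl : ∀ i, D.label i = E.label i) : D = E := by
  have hC' : ∀ i, D.partner i < i ↔ E.partner i < i := fun i => by
    rw [← mem_closers, ← mem_closers, hC]
  -- Scan the closing points from left to right. By induction the same points are open just before
  -- `i` in both diagrams; the label counts the open points after the one that `i` closes, so it
  -- singles out that point.
  have key : ∀ i, D.partner i < i → D.partner i = E.partner i := by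
    intro i
    induction i using WellFoundedLT.induction with
    | ind i ih =>
      intro hi
      have hi' := (hC' i).1 hi
      have hsub : ∀ x, x < i → (i ≤ D.partner x ↔ i ≤ E.partner x) := by
        intro x hx
        have aux : ∀ F G : ChordDiagram n, (∀ i, F.partner i < i ↔ G.partner i < i) →
            (∀ j < i, F.partner j < j → F.partner j = G.partner j) →
            i ≤ F.partner x → i ≤ G.partner x := by
          intro F G hFG hih h
          by_contra hlt
          push Not at hlt
          rcases G.partner_lt_or_gt x with h1 | h1
          · have := (hFG x).2 h1
            exact absurd (h.trans this.le) (not_le.2 hx)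
          · have h2 : G.partner (G.partner x) < G.partner x := by rwa [G.partner_partner]
            have h3 := hih _ hlt ((hFG _).2 h2)
            rw [G.partner_partner] at h3
            have h4 : F.partner x = G.partner x := by rw [← h3, F.partner_partner, h3]
            rw [h4] at h
            exact absurd h (not_le.2 hlt)
        exact ⟨aux D E hC' ih, aux E D (fun i => (hC' i).symm)
          (fun j hj h => (ih j hj ((hC' j).2 h)).symm)⟩
      have hne : ∀ (F : ChordDiagram n) x, F.partner i < x → (i ≤ F.partner x ↔ i < F.partner x) := by
        intro F x hx
        refine ⟨fun h => lt_of_le_of_ne h ?_, le_of_lt⟩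
        rintro h
        rw [h, F.partner_partner] at hx
        exact lt_irrefl _ hx
      have lab : ∀ F : ChordDiagram n, F.label i =
          (Finset.univ.filter fun x => F.partner i < x ∧ x < i ∧ i ≤ F.partner x).card := by
        intro F
        rw [label]
        congr 1
        ext x
        simp only [Finset.mem_filter, Finset.mem_univ, true_and]
        exact ⟨fun h => ⟨h.1, h.2.1, h.2.2.le⟩, fun h => ⟨h.1, h.2.1, (hne F x h.1).1 h.2.2⟩⟩
      have hcard := hl i
      rw [lab, lab] at hcard
      -- Closing an earlier opener gives a strictly larger label: the later opener is itself still
      -- open and is counted.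
      have strict : ∀ F G : ChordDiagram n, F.partner i < i → G.partner i < i →
          (∀ x, x < i → (i ≤ F.partner x ↔ i ≤ G.partner x)) → F.partner i < G.partner i →
          (Finset.univ.filter fun x => G.partner i < x ∧ x < i ∧ i ≤ G.partner x).card <
          (Finset.univ.filter fun x => F.partner i < x ∧ x < i ∧ i ≤ F.partner x).card := by
        intro F G _ hG hFG hlt
        apply Finset.card_lt_card
        rw [Finset.ssubset_iff_of_subset]
        · refine ⟨G.partner i, ?_, ?_⟩
          · simp only [Finset.mem_filter, Finset.mem_univ, true_and]
            refine ⟨hlt, hG, (hFG _ hG).2 ?_⟩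
            rw [G.partner_partner]
          · simp
        · intro x hx
          simp only [Finset.mem_filter, Finset.mem_univ, true_and] at hx ⊢
          exact ⟨hlt.trans hx.1, hx.2.1, (hFG x hx.2.1).2 hx.2.2⟩
      rcases lt_trichotomy (D.partner i) (E.partner i) with h | h | h
      · exact absurd hcard (strict D E hi hi' hsub h).ne'
      · exact h
      · exact absurd hcard (strict E D hi' hi (fun x hx => (hsub x hx).symm) h).ne
  apply ChordDiagram.ext
  funext i
  rcases D.partner_lt_or_gt i with h | h
  · exact key i h
  · have h2 : D.partner (D.partner i) < D.partner i := by rwa [D.partner_partner]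
    have h3 := key _ h2
    rw [D.partner_partner] at h3
    rw [h3, E.partner_partner, ← h3]

end ChordDiagram

/-! ### Upper bound: diagrams with a component of given size and crossings -/

theorem Finset.card_piAntidiag {ι : Type*} [DecidableEq ι] (s : Finset ι) (n : ℕ) :
    (Finset.piAntidiag s n).card = Nat.multichoose s.card n := by
  induction s using Finset.cons_induction generalizing n with
  | empty => cases n <;> simp
  | cons i s hi ih =>
    rw [Finset.piAntidiag_cons, Finset.card_disjiUnion, Finset.card_cons]
    simp only [Finset.card_map, ih]
    induction n with
    | zero => simp
    | succ n ihn =>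
      rw [Finset.Nat.sum_antidiagonal_succ, Nat.multichoose_succ_succ, ihn]

namespace ChordDiagram

variable {n : ℕ}

theorem chord_endpoints_ne {D : ChordDiagram n} {c d : D.Chord} (h : c ≠ d) :
    c.1.1 ≠ d.1.1 ∧ c.1.1 ≠ d.1.2 ∧ c.1.2 ≠ d.1.1 ∧ c.1.2 ≠ d.1.2 := by
  refine ⟨fun e => h ?_, fun e => h ?_, fun e => h ?_, fun e => h ?_⟩
  · rw [← chordAt_fst c, e, chordAt_fst]
  · rw [← chordAt_fst c, e, chordAt_snd]
  · rw [← chordAt_snd c, e, chordAt_fst]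
  · rw [← chordAt_snd c, e, chordAt_snd]

/-- A chord outside a component does not separate two points of the component. -/
theorem between_iff_of_mem_points {D : ChordDiagram n} {K : D.intersectionGraph.ConnectedComponent}
    {c : D.Chord} (hc : c ∉ K.supp) {s t : Fin (2 * n)} (hs : s ∈ D.points K)
    (ht : t ∈ D.points K) : (c.1.1 < s ∧ s < c.1.2) ↔ (c.1.1 < t ∧ t < c.1.2) := by
  have hne : ∀ d ∈ K.supp, c ≠ d := by
    rintro d hd rfl
    exact hc hd
  have hcross : ∀ d ∈ K.supp, ¬ Interleave c d ∧ ¬ Interleave d c := by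
    intro d hd
    have : ¬ D.intersectionGraph.Adj d c := fun h => hc (K.mem_supp_of_adj_mem_supp hd h)
    exact ⟨fun h => this (Or.inr h), fun h => this (Or.inl h)⟩
  have hpt : ∀ i, D.chordAt i ∈ K.supp →
      ((c.1.1 < i ∧ i < c.1.2) ↔ (c.1.1 < (D.chordAt i).1.1 ∧ (D.chordAt i).1.1 < c.1.2)) := by
    intro i hi
    rcases D.partner_lt_or_gt i with h | h
    · have h1 := hcross _ hi
      have h2 := chord_endpoints_ne (hne _ hi)
      rw [chordAt_of_partner_lt h] at h1 h2 ⊢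
      have h3 := c.2.1
      simp only [Interleave, chordClosingAt] at h1 h2 ⊢
      grind
    · rw [chordAt_of_lt_partner h]
      rfl
  -- Two crossing chords on different sides of `c` would force one of them to cross `c`;
  -- connectedness then spreads the side along a walk.
  have hadj : ∀ d e : D.Chord, d ∈ K.supp → e ∈ K.supp → D.intersectionGraph.Adj d e →
      ((c.1.1 < d.1.1 ∧ d.1.1 < c.1.2) ↔ (c.1.1 < e.1.1 ∧ e.1.1 < c.1.2)) := by
    intro d e hd he hde
    have h1 := hcross _ hd
    have h2 := hcross _ he
    have h3 := chord_endpoints_ne (hne _ hd)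
    have h4 := chord_endpoints_ne (hne _ he)
    have h5 : Interleave d e ∨ Interleave e d := hde
    have h6 := c.2.1
    have h7 := d.2.1
    have h8 := e.2.1
    simp only [Interleave] at h1 h2 h5
    grind
  have hwalk : ∀ d e : D.Chord, ∀ w : D.intersectionGraph.Walk d e, d ∈ K.supp →
      ((c.1.1 < d.1.1 ∧ d.1.1 < c.1.2) ↔ (c.1.1 < e.1.1 ∧ e.1.1 < c.1.2)) := by
    intro d e w
    induction w with
    | nil => exact fun _ => Iff.rfl
    | cons h w ih =>
      intro hd
      have hv := K.mem_supp_of_adj_mem_supp hd h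
      exact (hadj _ _ hd hv h).trans (ih hv)
  rw [mem_points] at hs ht
  rw [hpt s hs, hpt t ht]
  have hr : D.intersectionGraph.Reachable (D.chordAt s) (D.chordAt t) :=
    SimpleGraph.ConnectedComponent.exact (hs.trans ht.symm)
  obtain ⟨w⟩ := hr
  exact hwalk _ _ w hs

theorem not_separated {D : ChordDiagram n} {K : D.intersectionGraph.ConnectedComponent}
    {x : Fin (2 * n)} (hx : x ∉ D.points K) (h : D.partner x < x) {s t : Fin (2 * n)}
    (hs : s ∈ D.points K) (ht : t ∈ D.points K) :
    (D.partner x < s ∧ s < x) ↔ (D.partner x < t ∧ t < x) := by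
  rw [mem_points, chordAt_of_partner_lt h] at hx
  exact between_iff_of_mem_points hx hs ht

/-- The points of a component are determined by the first of them, their number, and the word
that marks these points and the closing points of the other chords. -/
theorem points_eq_of_union_eq [DecidableEq (Fin (2 * n))] {D E : ChordDiagram n}
    {K : D.intersectionGraph.ConnectedComponent}
    {L : E.intersectionGraph.ConnectedComponent} (hcard : (D.points K).card = (E.points L).card)
    (hmin : (D.points K).min = (E.points L).min)
    (hw : D.points K ∪ D.closers = E.points L ∪ E.closers) : D.points K = E.points L := by
  -- At the first disagreement `i`, let `s` be the last common point before it. The gap between them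
  -- has no component points, so its closers agree; balancing openers against closers in the gap
  -- gives opposite inequalities for `D` and `E`, and `i` is an extra closer in `E`.
  have aux : ∀ (D E : ChordDiagram n) (K : D.intersectionGraph.ConnectedComponent)
      (L : E.intersectionGraph.ConnectedComponent) (_ : (D.points K).card = (E.points L).card)
      (_ : (D.points K).min = (E.points L).min)
      (_ : D.points K ∪ D.closers = E.points L ∪ E.closers) (i : Fin (2 * n))
      (_ : ∀ j < i, (j ∈ D.points K ↔ j ∈ E.points L)), i ∈ D.points K → i ∈ E.points L := by
    intro D E K L hcard hmin hw i ih hi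
    by_contra hi'
    have hne : ((E.points L).filter (· < i)).Nonempty := by
      have hn : (D.points K).Nonempty := ⟨i, hi⟩
      have hn' : (E.points L).Nonempty := by
        rw [← Finset.card_pos, ← hcard, Finset.card_pos]; exact hn
      have h1 := (E.points L).min'_mem hn'
      refine ⟨(E.points L).min' hn', Finset.mem_filter.2 ⟨h1, ?_⟩⟩
      refine lt_of_le_of_ne ?_ (fun h => hi' (h ▸ h1))
      have h2 : (D.points K).min ≤ (i : WithTop (Fin (2 * n))) := Finset.min_le hi
      rw [hmin, ← Finset.coe_min' hn'] at h2
      exact_mod_cast h2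
    obtain ⟨s, hs, hmax⟩ : ∃ s ∈ (E.points L).filter (· < i),
        ∀ x ∈ (E.points L).filter (· < i), x ≤ s :=
      ⟨_, Finset.max'_mem _ hne, fun x hx => Finset.le_max' _ x hx⟩
    rw [Finset.mem_filter] at hs
    obtain ⟨hsE, hsi⟩ := hs
    have hsD := (ih s hsi).2 hsE
    have hgapE : ∀ x, s < x → x < i → x ∉ E.points L := fun x h1 h2 h3 =>
      absurd (hmax x (Finset.mem_filter.2 ⟨h3, h2⟩)) (not_le.2 h1)
    have hgapD : ∀ x, s < x → x < i → x ∉ D.points K := fun x h1 h2 h3 =>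
      hgapE x h1 h2 ((ih x h2).1 h3)
    -- Equal cardinalities force `E.points L` to continue beyond `i`, as it misses `i` and agrees
    -- with `D.points K` before it.
    obtain ⟨t, ht, hit⟩ : ∃ t ∈ E.points L, i < t := by
      by_contra hno
      push Not at hno
      have hlt : ∀ x ∈ E.points L, x < i := fun x hx =>
        lt_of_le_of_ne (hno x hx) (fun h => hi' (h ▸ hx))
      have hsub : E.points L ⊂ D.points K := by
        rw [Finset.ssubset_iff_of_subset (fun x hx => (ih x (hlt x hx)).2 hx)]
        exact ⟨i, hi, hi'⟩
      exact absurd hcard (Finset.card_lt_card hsub).ne'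
    have hC : ∀ x, s < x → x < i → (x ∈ D.closers ↔ x ∈ E.closers) := by
      intro x h1 h2
      have := Finset.ext_iff.1 hw x
      simpa only [Finset.mem_union, hgapD x h1 h2, hgapE x h1 h2, false_or] using this
    have hiE : i ∈ E.closers := by
      have := (Finset.ext_iff.1 hw i).1 (Finset.mem_union_left _ hi)
      exact (Finset.mem_union.1 this).resolve_left hi'
    -- In `E`, a chord closing in the gap or at `i` must open in the gap, otherwise it would
    -- separate `s` from `t`.
    have h1 : ((Finset.Ioc s i).filter (· ∈ E.closers)).card ≤
        ((Finset.Ioo s i).filter (· ∉ E.closers)).card := by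
      refine Finset.card_le_card_of_injOn E.partner ?_ E.involutive.injective.injOn
      intro x hx
      simp only [Finset.coe_filter, Set.mem_ofPred_eq, Finset.mem_Ioc, Finset.mem_Ioo,
        mem_closers, E.partner_partner] at hx ⊢
      obtain ⟨⟨hsx, hxi⟩, hxc⟩ := hx
      have hxE : x ∉ E.points L := by
        rcases hxi.lt_or_eq with h | rfl
        · exact hgapE x hsx h
        · exact hi'
      refine ⟨⟨?_, hxc.trans_le hxi⟩, hxc.not_gt⟩
      by_contra hlt
      have hne' : E.partner x ≠ s := fun h => hxE (partner_mem_points.1 (h ▸ hsE))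
      have hlt' := lt_of_le_of_ne (not_lt.1 hlt) hne'
      have := ((not_separated hxE hxc hsE ht).1 ⟨hlt', hsx⟩).2
      exact absurd (hxi.trans_lt hit) this.not_gt
    -- In `D`, a chord opening in the gap must close in it, otherwise it would separate `i` from
    -- `s`.
    have h2 : ((Finset.Ioo s i).filter (· ∉ D.closers)).card ≤
        ((Finset.Ioo s i).filter (· ∈ D.closers)).card := by
      refine Finset.card_le_card_of_injOn D.partner ?_ D.involutive.injective.injOn
      intro x hx
      simp only [Finset.coe_filter, Set.mem_ofPred_eq, Finset.mem_Ioo,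
        mem_closers, D.partner_partner] at hx ⊢
      obtain ⟨⟨hsx, hxi⟩, hxc⟩ := hx
      have hxc' := (D.partner_lt_or_gt x).resolve_left hxc
      have hpD : D.partner x ∉ D.points K := fun h =>
        hgapD x hsx hxi (partner_mem_points.1 h)
      refine ⟨⟨hsx.trans hxc', ?_⟩, hxc'⟩
      by_contra hlt
      have hne' : D.partner x ≠ i := fun h => hpD (h ▸ hi)
      have hlt' := lt_of_le_of_ne (not_lt.1 hlt) hne'.symm
      have h3 : D.partner (D.partner x) < D.partner x := by rwa [D.partner_partner]
      have := ((not_separated hpD h3 hi hsD).1 ⟨by rwa [D.partner_partner], hlt'⟩).1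
      rw [D.partner_partner] at this
      exact absurd hsx this.not_gt
    have h3 : (Finset.Ioo s i).filter (· ∉ D.closers) = (Finset.Ioo s i).filter (· ∉ E.closers) :=
      Finset.filter_congr fun x hx => not_congr (hC x (Finset.mem_Ioo.1 hx).1 (Finset.mem_Ioo.1 hx).2)
    have h4 : ((Finset.Ioo s i).filter (· ∈ D.closers)).card <
        ((Finset.Ioc s i).filter (· ∈ E.closers)).card := by
      apply Finset.card_lt_card
      rw [Finset.ssubset_iff_of_subset]
      · exact ⟨i, by simp only [Finset.mem_filter, Finset.mem_Ioc]; exact ⟨⟨hsi, le_rfl⟩, hiE⟩,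
          by simp⟩
      · intro x hx
        simp only [Finset.mem_filter, Finset.mem_Ioc, Finset.mem_Ioo] at hx ⊢
        exact ⟨⟨hx.1.1, hx.1.2.le⟩, (hC x hx.1.1 hx.1.2).1 hx.2⟩
    rw [h3] at h2
    omega
  ext i
  induction i using WellFoundedLT.induction with
  | ind i ih =>
    exact ⟨aux D E K L hcard hmin hw i ih,
      aux E D L K hcard.symm hmin.symm hw.symm i fun j hj => (ih j hj).symm⟩

theorem points_injective (D : ChordDiagram n) : Function.Injective D.points := by
  intro K L h
  obtain ⟨c, hc⟩ := K.nonempty_supp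
  have h1 : c.1.1 ∈ D.points K := by rwa [mem_points, chordAt_fst]
  rw [h, mem_points, chordAt_fst] at h1
  exact hc.symm.trans h1

open Classical in
/-- The number of pairs of a diagram with `m` crossings and a component of `D` with `k` chords and
`l` crossings. -/
theorem card_component_le (n m k l : ℕ) :
    Nat.card {D : ChordDiagram n // D.crossings = m ∧
      ∃ K, D.componentSize K = k ∧ D.componentCrossings K = l} ≤
    (2 * n + 1) * 4 ^ n * 4 ^ k * (k.multichoose l * (n - k).multichoose (m - l)) := by
  let P : (Σ D : ChordDiagram n, D.intersectionGraph.ConnectedComponent) → Prop := fun p =>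
    p.1.crossings = m ∧ p.1.componentSize p.2 = k ∧ p.1.componentCrossings p.2 = l
  have : Fintype (Σ D : ChordDiagram n, D.intersectionGraph.ConnectedComponent) :=
    Fintype.ofFinite _
  have hle : Nat.card {D : ChordDiagram n // D.crossings = m ∧
      ∃ K, D.componentSize K = k ∧ D.componentCrossings K = l} ≤
      (Finset.univ.filter P).card := by
    rw [← Fintype.card_subtype, ← Nat.card_eq_fintype_card]
    refine Nat.card_le_card_of_surjective (fun p : {p // P p} => ⟨p.1.1, p.2.1, p.1.2, p.2.2⟩) ?_
    rintro ⟨D, h, K, hK⟩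
    exact ⟨⟨⟨D, K⟩, h, hK⟩, rfl⟩
  refine hle.trans ?_
  let g : (Σ D : ChordDiagram n, D.intersectionGraph.ConnectedComponent) →
      Finset (Fin (2 * n)) × Finset (Fin (2 * n)) := fun p => (p.1.points p.2, p.1.closers)
  -- For fixed point set `S` and closers `C`, the labels determine the diagram and `S` determines
  -- the component; the labels form one composition on `S ∩ C` and one on `C \ S`.
  have hfib : (Finset.univ.filter P).card ≤
      (k.multichoose l * (n - k).multichoose (m - l)) * ((Finset.univ.filter P).image g).card := by
    apply Finset.card_le_mul_card_image
    rintro ⟨S, C⟩ hSC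
    obtain ⟨p₀, hp₀, hg₀⟩ := Finset.mem_image.1 hSC
    obtain ⟨D₀, K₀⟩ := p₀
    have hP₀ : P ⟨D₀, K₀⟩ := (Finset.mem_filter.1 hp₀).2
    simp only [g, Prod.mk.injEq] at hg₀
    have hc1 : (S ∩ C).card = k := by
      rw [← hg₀.1, ← hg₀.2, card_points_inter_closers]; exact hP₀.2.1
    have hc2 : (C \ S).card = n - k := by
      have h1 := Finset.card_inter_add_card_sdiff C S
      have h2 : C.card = n := by rw [← hg₀.2, card_closers]
      rw [Finset.inter_comm, hc1] at h1
      omega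
    have hprod : k.multichoose l * (n - k).multichoose (m - l) =
        (Finset.piAntidiag (S ∩ C) l ×ˢ Finset.piAntidiag (C \ S) (m - l)).card := by
      rw [Finset.card_product, Finset.card_piAntidiag, Finset.card_piAntidiag, hc1, hc2]
    rw [hprod]
    refine Finset.card_le_card_of_injOn
      (fun p => (fun i => if i ∈ S then p.1.label i else 0,
        fun i => if i ∈ S then 0 else p.1.label i)) ?_ ?_
    · rintro ⟨D, K⟩ hp
      simp only [Finset.coe_filter, Finset.mem_filter, Finset.mem_univ, true_and,
        Set.mem_ofPred_eq, g, Prod.mk.injEq] at hp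
      obtain ⟨⟨h1, h2, h3⟩, h4, h5⟩ := hp
      subst h4 h5
      have hlab : ∀ i, i ∉ D.closers → D.label i = 0 := fun i hi =>
        D.label_eq_zero ((D.partner_lt_or_gt i).resolve_left (by simpa using hi))
      have e1 : ∑ i ∈ D.points K ∩ D.closers, D.label i = l := by
        rw [← h3, componentCrossings_eq_sum_label]
        refine Finset.sum_subset Finset.inter_subset_left fun i hi hi' => hlab i fun h => hi' ?_
        exact Finset.mem_inter.2 ⟨hi, h⟩
      have e2 : ∑ i ∈ D.closers \ D.points K, D.label i = m - l := by
        have e3 : ∑ i ∈ D.closers, D.label i = m := by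
          rw [← h1]
          dsimp only
          rw [crossings_eq_sum_label]
          exact Finset.sum_subset (Finset.subset_univ _) fun i _ hi => hlab i hi
        rw [← Finset.sum_inter_add_sum_sdiff D.closers (D.points K), Finset.inter_comm, e1] at e3
        omega
      simp only [Finset.coe_product, Set.mem_prod, Finset.mem_coe, Finset.mem_piAntidiag]
      refine ⟨⟨?_, ?_⟩, ?_, ?_⟩
      · rw [← e1]
        exact Finset.sum_congr rfl fun i hi => if_pos (Finset.mem_inter.1 hi).1
      · intro i hi
        simp only [ne_eq, ite_eq_right_iff, Classical.not_imp] at hi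
        refine Finset.mem_inter.2 ⟨hi.1, ?_⟩
        by_contra h
        exact hi.2 (hlab i h)
      · rw [← e2]
        exact Finset.sum_congr rfl fun i hi => if_neg (Finset.mem_sdiff.1 hi).2
      · intro i hi
        simp only [ne_eq, ite_eq_left_iff, Classical.not_imp] at hi
        refine Finset.mem_sdiff.2 ⟨?_, hi.1⟩
        by_contra h
        exact hi.2 (hlab i h)
    · rintro ⟨D, K⟩ hp ⟨E, L⟩ hq heq
      simp only [Finset.coe_filter, Finset.mem_filter, Finset.mem_univ, true_and,
        Set.mem_ofPred_eq, g, Prod.mk.injEq] at hp hq heq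
      have hDE : D = E := by
        refine eq_of_closers_eq_of_label_eq (hp.2.2.trans hq.2.2.symm) fun i => ?_
        by_cases hi : i ∈ S
        · simpa [hi] using congrFun heq.1 i
        · simpa [hi] using congrFun heq.2 i
      subst hDE
      rw [D.points_injective (hp.2.1.trans hq.2.1.symm)]
  have himg : ((Finset.univ.filter P).image g).card ≤ 4 ^ k * ((2 * n + 1) * 4 ^ n) := by
    let f : Finset (Fin (2 * n)) × Finset (Fin (2 * n)) →
      WithTop (Fin (2 * n)) × Finset (Fin (2 * n)) := fun q => (q.1.min, q.1 ∪ q.2)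
    have huniv : Fintype.card (WithTop (Fin (2 * n)) × Finset (Fin (2 * n))) =
        (2 * n + 1) * 4 ^ n := by
      rw [Fintype.card_prod, Fintype.card_finset, Fintype.card_fin]
      congr 1
      · exact (Fintype.card_option).trans (by rw [Fintype.card_fin])
      · rw [pow_mul]; norm_num
    rw [← huniv, ← Finset.card_univ]
    refine Finset.card_le_mul_card_image_of_maps_to (f := f) (fun _ _ => Finset.mem_univ _) _ ?_
    rintro ⟨r, w⟩ -
    rcases Finset.eq_empty_or_nonempty
      (((Finset.univ.filter P).image g).filter fun q => f q = (r, w)) with he | ⟨q₀, hq₀⟩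
    · rw [he]; simp
    obtain ⟨hq₀, hf₀⟩ := Finset.mem_filter.1 hq₀
    obtain ⟨p₀, hp₀, rfl⟩ := Finset.mem_image.1 hq₀
    obtain ⟨D₀, K₀⟩ := p₀
    have hP₀ : P ⟨D₀, K₀⟩ := (Finset.mem_filter.1 hp₀).2
    simp only [f, g, Prod.mk.injEq] at hf₀
    have hS : ∀ q ∈ ((Finset.univ.filter P).image g).filter fun q => f q = (r, w),
        q.1 = D₀.points K₀ ∧ q.1 ∪ q.2 = w := by
      intro q hq
      obtain ⟨hq, hf⟩ := Finset.mem_filter.1 hq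
      obtain ⟨p, hp, rfl⟩ := Finset.mem_image.1 hq
      obtain ⟨D, K⟩ := p
      have hP : P ⟨D, K⟩ := (Finset.mem_filter.1 hp).2
      simp only [f, g, Prod.mk.injEq] at hf ⊢
      refine ⟨points_eq_of_union_eq ?_ (hf.1.trans hf₀.1.symm) (hf.2.trans hf₀.2.symm), hf.2⟩
      rw [card_points, card_points]
      exact congrArg (2 * ·) (hP.2.1.trans hP₀.2.1.symm)
    have hk : 4 ^ k = (D₀.points K₀).powerset.card := by
      rw [Finset.card_powerset, card_points, pow_mul]
      exact congrArg (4 ^ ·) hP₀.2.1.symm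
    rw [hk]
    -- With `S` and `S ∪ C` known, `C` is given by `S ∩ C`, a subset of the `2k` points of `S`: this
    -- is the factor `4 ^ k`.
    refine Finset.card_le_card_of_injOn (fun q => q.1 ∩ q.2) ?_ ?_
    · intro q hq
      rw [Finset.mem_coe, Finset.mem_powerset, ← (hS q hq).1]
      exact Finset.inter_subset_left
    · intro q hq q' hq' he
      have h1 := hS q hq
      have h2 := hS q' hq'
      refine Prod.ext (h1.1.trans h2.1.symm) ?_
      have h3 := h1.2.trans h2.2.symm
      simp only at he
      rw [h1.1, h2.1] at he h3
      ext i
      have e1 := Finset.ext_iff.1 he i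
      have e2 := Finset.ext_iff.1 h3 i
      simp only [Finset.mem_inter, Finset.mem_union] at e1 e2
      tauto
  calc _ ≤ _ := hfib
    _ ≤ _ := Nat.mul_le_mul_left _ himg
    _ = _ := by ring

end ChordDiagram

/-! ### Diagrams as weighted Dyck paths -/

/-- The transfer operator of lattice paths with weight `1` on up-steps and weight `w h` on the
down-step from height `h` to height `h - 1`. -/
def transfer {R : Type*} [CommSemiring R] (w : ℕ → R) (f : ℕ → R) (h : ℕ) : R :=
  f (h + 1) + w h * f (h - 1)

/-- The `q`-analogue of the integer `h`, as a polynomial. -/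
noncomputable def qNumber (h : ℕ) : Polynomial ℕ := ∑ a ∈ Finset.range h, Polynomial.X ^ a

/-- The number of larger elements takes each value below the cardinality exactly once, and a new
minimum has the top rank. This matches the monomials of a q-number with the open points available
for closing. -/
theorem Finset.sum_range_card_eq_sum_rank {α M : Type*} [LinearOrder α] [AddCommMonoid M]
    (s : Finset α) (g : ℕ → M) :
    ∑ a ∈ Finset.range s.card, g a = ∑ x ∈ s, g (s.filter (x < ·)).card := by
  induction s using Finset.induction_on_min with
  | empty => simp
  | insert a s ha ih =>
    have hn : a ∉ s := fun h => lt_irrefl _ (ha a h)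
    rw [Finset.card_insert_of_notMem hn, Finset.sum_range_succ, ih, Finset.sum_insert hn, add_comm]
    congr 1
    · rw [Finset.filter_insert, if_neg (lt_irrefl a), Finset.filter_true_of_mem ha]
    · refine Finset.sum_congr rfl fun x hx => ?_
      rw [Finset.filter_insert, if_neg (ha x hx).not_gt]

namespace ChordDiagram

variable {n : ℕ}

/-- The diagrams that extend the matching `σ` of the points before `t`, in which the fixed points
of `σ` are still to be closed, with labels summing to `m` from `t` on. -/
def extensions [Fintype (ChordDiagram n)] (σ : Fin (2 * n) → Fin (2 * n)) (t m : ℕ) :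
    Finset (ChordDiagram n) :=
  Finset.univ.filter fun D => (∀ i : Fin (2 * n), i.val < t →
    (σ i ≠ i → D.partner i = σ i) ∧ (σ i = i → t ≤ (D.partner i).val)) ∧
    ∑ i ∈ Finset.univ.filter (fun i : Fin (2 * n) => t ≤ i.val), D.label i = m

theorem mem_extensions [Fintype (ChordDiagram n)] {σ : Fin (2 * n) → Fin (2 * n)} {t m : ℕ}
    {D : ChordDiagram n} : D ∈ extensions σ t m ↔ (∀ i : Fin (2 * n), i.val < t →
    (σ i ≠ i → D.partner i = σ i) ∧ (σ i = i → t ≤ (D.partner i).val)) ∧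
    ∑ i ∈ Finset.univ.filter (fun i : Fin (2 * n) => t ≤ i.val), D.label i = m := by
  simp [extensions]

theorem sum_label_from (D : ChordDiagram n) {t : ℕ} (ht : t < 2 * n) :
    ∑ i ∈ Finset.univ.filter (fun i : Fin (2 * n) => t ≤ i.val), D.label i =
    D.label ⟨t, ht⟩ + ∑ i ∈ Finset.univ.filter (fun i : Fin (2 * n) => t + 1 ≤ i.val), D.label i := by
  rw [← Finset.sum_insert (by simp)]
  congr 1
  ext i
  simp only [Finset.mem_filter, Finset.mem_univ, true_and, Finset.mem_insert, Fin.ext_iff]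
  omega

theorem extensions_open_subset [Fintype (ChordDiagram n)] {σ : Fin (2 * n) → Fin (2 * n)} {t m : ℕ}
    (ht : t < 2 * n) (hfix : ∀ i : Fin (2 * n), t ≤ i.val → σ i = i) :
    extensions σ (t + 1) m ⊆ extensions σ t m := by
  intro D hD
  rw [mem_extensions] at hD ⊢
  refine ⟨fun i hi => ?_, ?_⟩
  · have := hD.1 i (by omega)
    exact ⟨this.1, fun h => (Nat.le_succ t).trans (this.2 h)⟩
  · rw [sum_label_from D ht, hD.2, label_eq_zero, zero_add]
    exact (hD.1 ⟨t, ht⟩ (Nat.lt_succ_self t)).2 (hfix _ le_rfl)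

/-- Extend the matching `σ` by the pair `x`, `y`. -/
def addPair (σ : Fin (2 * n) → Fin (2 * n)) (x y : Fin (2 * n)) (i : Fin (2 * n)) : Fin (2 * n) :=
  if i = x then y else if i = y then x else σ i

theorem addPair_involutive {σ : Fin (2 * n) → Fin (2 * n)} (hσ : Function.Involutive σ)
    {x y : Fin (2 * n)} (hx : σ x = x) (hy : σ y = y) :
    Function.Involutive (addPair σ x y) := by
  intro i
  have h1 : σ i = x → i = x := fun h => by rw [← hσ i, h, hx]
  have h2 : σ i = y → i = y := fun h => by rw [← hσ i, h, hy]
  have h3 := hσ i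
  simp only [addPair]
  split_ifs <;> simp_all

/-- When `t` closes `x`, its label is the number of open points after `x`, which is exactly the
amount `r` removed from the remaining sum. -/
theorem extensions_close_subset [Fintype (ChordDiagram n)] {σ : Fin (2 * n) → Fin (2 * n)}
    (hσ : Function.Involutive σ) {t m : ℕ}
    (ht : t < 2 * n) (hfix : ∀ i : Fin (2 * n), t ≤ i.val → σ i = i) {x : Fin (2 * n)}
    (hxt : x.val < t) (hx : σ x = x) {r : ℕ} (hr : r ≤ m)
    (hrank : r = ((Finset.univ.filter fun i : Fin (2 * n) => i.val < t ∧ σ i = i).filter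
      (x < ·)).card) :
    extensions (addPair σ x ⟨t, ht⟩) (t + 1) (m - r) ⊆ extensions σ t m := by
  intro D hD
  rw [mem_extensions] at hD ⊢
  obtain ⟨h1, h2⟩ := hD
  have hxne : x ≠ ⟨t, ht⟩ := fun h => by rw [h] at hxt; exact lt_irrefl _ hxt
  have hpx : D.partner x = ⟨t, ht⟩ := by
    have := (h1 x (by omega)).1
    simp only [addPair, if_true] at this
    exact this hxne.symm
  have hpt : D.partner ⟨t, ht⟩ = x := by rw [← hpx, D.partner_partner]
  have hold : ∀ i : Fin (2 * n), i.val < t → i ≠ x → addPair σ x ⟨t, ht⟩ i = σ i := by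
    intro i hi hix
    have : i ≠ ⟨t, ht⟩ := fun h => by rw [h] at hi; exact lt_irrefl _ hi
    simp [addPair, hix, this]
  have hopen : ∀ i : Fin (2 * n), i.val < t → i ≠ x → σ i = i → t + 1 ≤ (D.partner i).val := by
    intro i hi hix hs
    exact (h1 i (by omega)).2 (by rw [hold i hi hix, hs])
  have hclosed : ∀ i : Fin (2 * n), i.val < t → σ i ≠ i → D.partner i = σ i := by
    intro i hi hs
    have hix : i ≠ x := fun h => hs (by rw [h, hx])
    rw [← hold i hi hix]
    exact (h1 i (by omega)).1 (by rwa [hold i hi hix])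
  have hσlt : ∀ i : Fin (2 * n), i.val < t → (σ i).val < t := by
    intro i hi
    by_contra hlt
    have := hfix _ (not_lt.1 hlt)
    rw [hσ i] at this
    rw [← this] at hlt
    exact hlt hi
  refine ⟨fun i hi => ⟨hclosed i hi, fun hs => ?_⟩, ?_⟩
  · by_cases hix : i = x
    · rw [hix, hpx]
    · exact (Nat.le_succ t).trans (hopen i hi hix hs)
  · have hlab : D.label ⟨t, ht⟩ = r := by
      rw [hrank, label, Finset.filter_filter, hpt]
      congr 1
      ext y
      simp only [Finset.mem_filter, Finset.mem_univ, true_and, Fin.lt_def]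
      constructor
      · rintro ⟨hy1, hy2, hy3⟩
        refine ⟨⟨hy2, ?_⟩, hy1⟩
        by_contra hs
        rw [hclosed y hy2 hs] at hy3
        exact absurd hy3 (hσlt y hy2).not_gt
      · rintro ⟨⟨hy1, hy2⟩, hy3⟩
        refine ⟨hy3, hy1, ?_⟩
        exact hopen y hy1 (fun h => by rw [h] at hy3; exact lt_irrefl _ hy3) hy2
    rw [sum_label_from D ht, h2, hlab]
    omega

open Classical in
/-- The paths counted by the iterated transfer operator give extensions of partial matchings. -/
theorem coeff_transfer_le_card_extensions [Fintype (ChordDiagram n)] (u t : ℕ) (htu : t + u = 2 * n)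
    (σ : Fin (2 * n) → Fin (2 * n)) (hσ : Function.Involutive σ)
    (hfix : ∀ i : Fin (2 * n), t ≤ i.val → σ i = i) (m : ℕ) :
    ((transfer qNumber)^[u] (Pi.single 0 1)
      (Finset.univ.filter fun i : Fin (2 * n) => i.val < t ∧ σ i = i).card).coeff m ≤
    (extensions σ t m).card := by
  induction u generalizing t σ m with
  | zero =>
    simp only [Function.iterate_zero, id]
    by_cases h0 : (Finset.univ.filter fun i : Fin (2 * n) => i.val < t ∧ σ i = i).card = 0
    · rw [h0, Pi.single_eq_same, Polynomial.coeff_one]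
      split_ifs with hm
      · rw [Finset.card_eq_zero, Finset.filter_eq_empty_iff] at h0
        have hne : ∀ i, σ i ≠ i := fun i hi =>
          h0 (Finset.mem_univ i) ⟨by have := i.2; omega, hi⟩
        rw [Nat.one_le_iff_ne_zero, ← Nat.pos_iff_ne_zero, Finset.card_pos]
        refine ⟨⟨σ, hσ, hne⟩, mem_extensions.2 ⟨fun i _ => ⟨fun _ => rfl, fun h =>
          absurd h (hne i)⟩, ?_⟩⟩
        rw [hm]
        refine Finset.sum_eq_zero fun i hi => ?_
        have h1 := (Finset.mem_filter.1 hi).2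
        have h2 := i.2
        omega
      · exact Nat.zero_le _
    · rw [Pi.single_eq_of_ne h0]
      simp
  | succ u ih =>
    have ht : t < 2 * n := by omega
    -- The open points; their number is the height of the path at time `t`.
    set O := Finset.univ.filter fun i : Fin (2 * n) => i.val < t ∧ σ i = i with hO
    have hmemO : ∀ i, i ∈ O ↔ i.val < t ∧ σ i = i := fun i => by simp [hO]
    have htO : (⟨t, ht⟩ : Fin (2 * n)) ∉ O := by simp [hO]
    have hopen : (Finset.univ.filter fun i : Fin (2 * n) => i.val < t + 1 ∧ σ i = i).card =
        O.card + 1 := by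
      rw [← Finset.card_insert_of_notMem htO]
      congr 1
      ext i
      simp only [Finset.mem_filter, Finset.mem_univ, true_and, Finset.mem_insert, hmemO,
        Fin.ext_iff]
      constructor
      · rintro ⟨h1, h2⟩
        rcases Nat.lt_succ_iff_lt_or_eq.1 h1 with h | h
        · exact Or.inr ⟨h, h2⟩
        · exact Or.inl h
      · rintro (h | h)
        · exact ⟨by omega, by rw [← Fin.ext_iff]; exact hfix i h.ge⟩
        · exact ⟨by omega, h.2⟩
    have hclose : ∀ x ∈ O, (Finset.univ.filter fun i : Fin (2 * n) =>
        i.val < t + 1 ∧ addPair σ x ⟨t, ht⟩ i = i).card = O.card - 1 := by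
      intro x hx
      rw [← Finset.card_erase_of_mem hx]
      have hxt := ((hmemO x).1 hx).1
      congr 1
      ext i
      rw [Finset.mem_filter, Finset.mem_erase, hmemO]
      simp only [Finset.mem_univ, true_and, addPair]
      split_ifs with h1 h2
      · rw [h1, Fin.ext_iff]
        simp only [ne_eq, not_true_eq_false, false_and, iff_false, not_and]
        intro _
        exact hxt.ne'
      · rw [h2]
        simp [Fin.ext_iff, hxt.ne]
      · rw [Fin.ext_iff] at h2
        simp only at h2
        constructor
        · rintro ⟨h3, h4⟩
          exact ⟨h1, by omega, h4⟩
        · rintro ⟨-, h3, h4⟩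
          exact ⟨by omega, h4⟩
    have hih1 := ih (t + 1) (by omega) σ hσ (fun i hi => hfix i (by omega)) m
    rw [hopen] at hih1
    have hih2 : ∀ x ∈ O, ∀ m', ((transfer qNumber)^[u] (Pi.single 0 1) (O.card - 1)).coeff m' ≤
        (extensions (addPair σ x ⟨t, ht⟩) (t + 1) m').card := by
      intro x hx m'
      have hx' := (hmemO x).1 hx
      rw [← hclose x hx]
      refine ih (t + 1) (by omega) _ (addPair_involutive hσ hx'.2 (hfix _ le_rfl)) ?_ m'
      intro i hi
      have h1 : i ≠ x := fun h => by rw [h] at hi; omega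
      have h2 : i ≠ ⟨t, ht⟩ := fun h => by rw [h] at hi; simp at hi
      simp only [addPair, if_neg h1, if_neg h2]
      exact hfix i (by omega)
    let r : Fin (2 * n) → ℕ := fun x => (O.filter (x < ·)).card
    -- The diagrams in which `t` closes `x`. They are disjoint for different `x`, and disjoint from
    -- those in which `t` opens a chord.
    let B : Fin (2 * n) → Finset (ChordDiagram n) := fun x =>
      if r x ≤ m then extensions (addPair σ x ⟨t, ht⟩) (t + 1) (m - r x) else ∅
    have hBp : ∀ x ∈ O, ∀ D ∈ B x, D.partner ⟨t, ht⟩ = x := by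
      intro x hx D hD
      have hxt := ((hmemO x).1 hx).1
      simp only [B] at hD
      split_ifs at hD with h
      · have hne : (⟨t, ht⟩ : Fin (2 * n)) ≠ x := fun h => by rw [← h] at hxt; simp at hxt
        have := ((mem_extensions.1 hD).1 ⟨t, ht⟩ (Nat.lt_succ_self t)).1
        simp only [addPair, if_neg hne, if_true] at this
        exact this hne.symm
      · simp at hD
    rw [Function.iterate_succ_apply', transfer, Polynomial.coeff_add, qNumber, Finset.sum_mul,
      Polynomial.finsetSum_coeff]
    simp only [Polynomial.coeff_X_pow_mul']
    rw [Finset.sum_range_card_eq_sum_rank]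
    calc _ ≤ (extensions σ (t + 1) m).card + ∑ x ∈ O, (B x).card := by
          refine Nat.add_le_add hih1 (Finset.sum_le_sum fun x hx => ?_)
          simp only [B, r]
          split_ifs
          · exact hih2 x hx _
          · exact Nat.zero_le _
      _ = (extensions σ (t + 1) m ∪ O.biUnion B).card := by
          rw [Finset.card_union_of_disjoint, Finset.card_biUnion]
          · intro x hx y hy hxy
            rw [Function.onFun, Finset.disjoint_left]
            intro D hD hD'
            exact hxy ((hBp x hx D hD).symm.trans (hBp y hy D hD'))
          · rw [Finset.disjoint_left]
            intro D hD hD'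
            obtain ⟨x, hx, hDx⟩ := Finset.mem_biUnion.1 hD'
            have h1 := ((mem_extensions.1 hD).1 ⟨t, ht⟩ (Nat.lt_succ_self t)).2 (hfix _ le_rfl)
            rw [hBp x hx D hDx] at h1
            have := ((hmemO x).1 hx).1
            omega
      _ ≤ (extensions σ t m).card := by
          refine Finset.card_le_card (Finset.union_subset (extensions_open_subset ht hfix) ?_)
          refine Finset.biUnion_subset.2 fun x hx => ?_
          have hx' := (hmemO x).1 hx
          simp only [B]
          split_ifs with h
          · exact extensions_close_subset hσ ht hfix hx'.1 hx'.2 h (by simp only [r, hO])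
          · exact Finset.empty_subset _

/-- Weighted Dyck paths give a lower bound for the number of diagrams with `m` crossings. -/
theorem coeff_transfer_le_card (n m : ℕ) :
    ((transfer qNumber)^[2 * n] (Pi.single 0 1) 0).coeff m ≤
      Nat.card {D : ChordDiagram n // D.crossings = m} := by
  classical
  have : Fintype (ChordDiagram n) := Fintype.ofFinite _
  have h := coeff_transfer_le_card_extensions (n := n) (2 * n) 0 (by simp) id
    (fun _ => rfl) (fun _ _ => rfl) m
  simp only [Nat.not_lt_zero, false_and, Finset.filter_false, Finset.card_empty] at h
  refine h.trans (le_of_eq ?_)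
  rw [Nat.card_eq_fintype_card, Fintype.card_subtype]
  congr 1
  ext D
  simp [mem_extensions, crossings_eq_sum_label]

end ChordDiagram

/-! ### Algebra of the transfer operator -/

section Transfer

variable {R : Type*} [CommSemiring R]

theorem transfer_iterate_succ (w f : ℕ → R) (t h : ℕ) :
    (transfer w)^[t + 1] f h =
      (transfer w)^[t] f (h + 1) + w h * (transfer w)^[t] f (h - 1) := by
  rw [Function.iterate_succ_apply']; rfl

theorem transfer_iterate_add (w f g : ℕ → R) (t h : ℕ) :
    (transfer w)^[t] (f + g) h = (transfer w)^[t] f h + (transfer w)^[t] g h := by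
  induction t generalizing h with
  | zero => rfl
  | succ t ih => simp only [transfer_iterate_succ, ih]; ring

theorem transfer_iterate_mul (w f : ℕ → R) (c : R) (t h : ℕ) :
    (transfer w)^[t] (fun j => c * f j) h = c * (transfer w)^[t] f h := by
  induction t generalizing h with
  | zero => rfl
  | succ t ih => simp only [transfer_iterate_succ, ih]; ring

theorem map_transfer_iterate {S : Type*} [CommSemiring S] (φ : R →+* S) (w f : ℕ → R) (t h : ℕ) :
    φ ((transfer w)^[t] f h) = (transfer fun j => φ (w j))^[t] (fun j => φ (f j)) h := by
  induction t generalizing h with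
  | zero => rfl
  | succ t ih => simp only [transfer_iterate_succ, map_add, map_mul, ih]

/-- Peels off the last step of a path instead of the first, as reversal requires. The condition `w 0
= 0` kills the spurious step caused by `0 - 1 = 0`. -/
theorem transfer_single (w : ℕ → R) (hw : w 0 = 0) (i : ℕ) :
    transfer w (Pi.single (i + 1) 1) =
      Pi.single i 1 + fun j => w (i + 2) * (Pi.single (i + 2) 1 : ℕ → R) j := by
  funext h
  simp only [transfer, Pi.add_apply, Pi.single_apply]
  rcases h with _ | h
  · rcases i with _ | i <;> simp [hw]
  · simp only [Nat.add_right_cancel_iff, Nat.add_sub_cancel]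
    congr 1
    by_cases h1 : h = i + 1
    · subst h1; simp
    · simp [h1]

theorem transfer_single_zero (w : ℕ → R) (hw : w 0 = 0) :
    transfer w (Pi.single 0 1) = fun j => w 1 * (Pi.single 1 1 : ℕ → R) j := by
  funext h
  simp only [transfer, Pi.single_apply]
  rcases h with _ | _ | h <;> simp [hw]

/-- Reversal of paths. -/
theorem transfer_symm (w : ℕ → R) (hw : w 0 = 0) (t i j : ℕ) :
    (∏ k ∈ Finset.range j, w (k + 1)) * (transfer w)^[t] (Pi.single j 1) i =
      (∏ k ∈ Finset.range i, w (k + 1)) * (transfer w)^[t] (Pi.single i 1) j := by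
  induction t generalizing i j with
  | zero =>
    simp only [Function.iterate_zero, id, Pi.single_apply]
    by_cases h : i = j
    · subst h; rfl
    · simp [h, Ne.symm h]
  | succ t ih =>
    rw [transfer_iterate_succ, Function.iterate_succ_apply, mul_add, ih (i + 1) j,
      Finset.prod_range_succ]
    rcases i with _ | i
    · rw [transfer_single_zero w hw, transfer_iterate_mul, hw]
      simp
    · rw [transfer_single w hw, transfer_iterate_add, transfer_iterate_mul, mul_left_comm,
        Nat.add_sub_cancel, ih i j, Finset.prod_range_succ]
      ring

/-- A path of `t` steps from `h` to `j` has `(h + t - j) / 2` down-steps, so dividing each weight by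
`c ^ 2` costs `c ^ (h + t - j)`. -/
theorem transfer_iterate_rescale {K : Type*} [Field K] (c : K) (hc : c ≠ 0) (w f : ℕ → K)
    (hw : w 0 = 0) (t h : ℕ) :
    c ^ (h + t) * (transfer fun j => w j / c ^ 2)^[t] f h =
      (transfer w)^[t] (fun j => c ^ j * f j) h := by
  induction t generalizing h with
  | zero => simp
  | succ t ih =>
    rw [transfer_iterate_succ, transfer_iterate_succ, ← ih, ← ih]
    rcases h with _ | h
    · simp only [hw]; ring
    · simp only [Nat.add_sub_cancel]
      field_simp
      ring

end Transfer

/-! ### Coefficientwise lower bounds for path polynomials -/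

section CoeffLE

open Polynomial

/-- Coefficientwise comparison of polynomials. -/
def CoeffLE (f g : ℕ[X]) : Prop := ∀ m, f.coeff m ≤ g.coeff m

theorem CoeffLE.refl (f : ℕ[X]) : CoeffLE f f := fun _ => le_rfl

theorem CoeffLE.trans {f g h : ℕ[X]} (h1 : CoeffLE f g) (h2 : CoeffLE g h) : CoeffLE f h :=
  fun m => (h1 m).trans (h2 m)

theorem CoeffLE.zero (f : ℕ[X]) : CoeffLE 0 f := fun m => by simp

theorem CoeffLE.add {f g f' g' : ℕ[X]} (h : CoeffLE f g) (h' : CoeffLE f' g') :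
    CoeffLE (f + f') (g + g') := fun m => by
  rw [coeff_add, coeff_add]; exact add_le_add (h m) (h' m)

theorem CoeffLE.mul {f g f' g' : ℕ[X]} (h : CoeffLE f g) (h' : CoeffLE f' g') :
    CoeffLE (f * f') (g * g') := fun m => by
  rw [coeff_mul, coeff_mul]
  exact Finset.sum_le_sum fun p _ => Nat.mul_le_mul (h _) (h' _)

theorem CoeffLE.transfer_iterate {w f g : ℕ → ℕ[X]} (hfg : ∀ h, CoeffLE (f h) (g h)) (t h : ℕ) :
    CoeffLE ((transfer w)^[t] f h) ((transfer w)^[t] g h) := by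
  induction t generalizing h with
  | zero => exact hfg h
  | succ t ih =>
    rw [transfer_iterate_succ, transfer_iterate_succ]
    exact (ih _).add ((CoeffLE.refl _).mul (ih _))

theorem coeffLE_mul_single (f : ℕ → ℕ[X]) {H : ℕ} {c : ℕ[X]} (hc : CoeffLE c (f H)) (h : ℕ) :
    CoeffLE (c * (Pi.single H 1 : ℕ → ℕ[X]) h) (f h) := by
  by_cases hh : h = H
  · subst hh; simpa using hc
  · simpa [Pi.single_eq_of_ne hh] using CoeffLE.zero _

theorem coeff_qNumber (h m : ℕ) : (qNumber h).coeff m = if m < h then 1 else 0 := by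
  simp [qNumber, coeff_X_pow]

theorem qNumber_coeffLE {a b : ℕ} (h : a ≤ b) : CoeffLE (qNumber a) (qNumber b) := fun m => by
  rw [coeff_qNumber, coeff_qNumber]
  split_ifs <;> omega

theorem natDegree_qNumber_le (h : ℕ) : (qNumber h).natDegree ≤ h := by
  rw [natDegree_le_iff_coeff_eq_zero]
  intro m hm
  rw [coeff_qNumber, if_neg (by omega)]

/-- Heights stay at most `h + t`, and each step contributes degree at most the height. This limits
how far the outer parts can shift the coefficient index of the middle part. -/
theorem natDegree_transfer_le (H t h : ℕ) :
    ((transfer qNumber)^[t] (Pi.single H 1) h).natDegree ≤ t * (h + t) := by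
  induction t generalizing h with
  | zero =>
    simp only [Function.iterate_zero, id, Pi.single_apply]
    split_ifs <;> simp
  | succ t ih =>
    rw [transfer_iterate_succ]
    refine (natDegree_add_le _ _).trans (max_le ((ih _).trans (by nlinarith)) ?_)
    refine natDegree_mul_le.trans ?_
    have h1 := natDegree_qNumber_le h
    have h2 := ih (h - 1)
    have h3 : t * (h - 1 + t) ≤ t * (h + t) := Nat.mul_le_mul_left _ (by omega)
    nlinarith

/-- Lower bound for the weighted paths that stay above a height `H`, by ballot numbers. -/
theorem exists_ballot_coeffLE (H t u d : ℕ) (htu : u + d = t) (hud : u ≤ d) :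
    ∃ b : ℕ, b + (if u = 0 then 0 else t.choose (u - 1)) = t.choose u ∧
      CoeffLE ((b : ℕ[X]) * qNumber (H + 1) ^ d)
        ((transfer qNumber)^[t] (Pi.single H 1) (H + (d - u))) := by
  induction t generalizing u d with
  | zero =>
    obtain ⟨rfl, rfl⟩ : u = 0 ∧ d = 0 := by omega
    exact ⟨1, by simp, by simpa using CoeffLE.refl _⟩
  | succ t ih =>
    have hdown : ∀ b : ℕ, u + 1 ≤ d → CoeffLE ((b : ℕ[X]) * qNumber (H + 1) ^ (d - 1))
        ((transfer qNumber)^[t] (Pi.single H 1) (H + (d - 1 - u))) →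
        CoeffLE ((b : ℕ[X]) * qNumber (H + 1) ^ d) (qNumber (H + (d - u)) *
          (transfer qNumber)^[t] (Pi.single H 1) (H + (d - u) - 1)) := by
      intro b hd hb
      have e1 : (b : ℕ[X]) * qNumber (H + 1) ^ d =
          qNumber (H + 1) * ((b : ℕ[X]) * qNumber (H + 1) ^ (d - 1)) := by
        obtain ⟨e, rfl⟩ : ∃ e, d = e + 1 := ⟨d - 1, by omega⟩
        rw [Nat.add_sub_cancel]; ring
      rw [e1, show H + (d - u) - 1 = H + (d - 1 - u) by omega]
      exact (qNumber_coeffLE (by omega)).mul hb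
    rw [transfer_iterate_succ]
    rcases u with _ | v
    · obtain ⟨b, hb, hb'⟩ := ih 0 (d - 1) (by omega) (by omega)
      refine ⟨b, by simpa using hb, ?_⟩
      simpa using (CoeffLE.zero _).add (hdown b (by omega) hb')
    · obtain ⟨b, hb, hb'⟩ := ih v d (by omega) (by omega)
      rw [show H + (d - v) = H + (d - (v + 1)) + 1 by omega] at hb'
      have hpas : ((t + 1).choose v : ℕ) = t.choose v + if v = 0 then 0 else t.choose (v - 1) := by
        rcases v with _ | v
        · simp
        · simp [Nat.choose_succ_succ, add_comm]
      simp only [Nat.add_sub_cancel, Nat.add_eq_zero_iff, one_ne_zero, and_false, if_false]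
      -- At height `H` itself a down-step would leave the region and is dropped; the corresponding
      -- ballot number is zero by symmetry of binomials.
      by_cases hk : v + 1 = d
      · refine ⟨b, ?_, ?_⟩
        · have : t.choose (v + 1) = t.choose v := Nat.choose_symm_of_eq_add (by omega)
          rw [hpas, Nat.choose_succ_succ, this]
          omega
        · simpa using hb'.add (CoeffLE.zero _)
      · obtain ⟨b2, hb2, hb2'⟩ := ih (v + 1) (d - 1) (by omega) (by omega)
        refine ⟨b + b2, ?_, ?_⟩
        · simp only [Nat.add_sub_cancel, Nat.add_eq_zero_iff, one_ne_zero, and_false,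
            if_false] at hb2
          rw [hpas, Nat.choose_succ_succ, Nat.succ_eq_add_one]
          omega
        · rw [Nat.cast_add, add_mul]
          exact hb'.add (hdown b2 (by omega) hb2')

theorem exists_catalan_coeffLE (H N : ℕ) :
    ∃ b : ℕ, b * (N + 1) = N.centralBinom ∧ CoeffLE ((b : ℕ[X]) * qNumber (H + 1) ^ N)
        ((transfer qNumber)^[2 * N] (Pi.single H 1) H) := by
  obtain ⟨b, hb, hb'⟩ := exists_ballot_coeffLE H (2 * N) N N (by ring) le_rfl
  refine ⟨b, ?_, by simpa using hb'⟩
  rw [Nat.centralBinom]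
  rcases N with _ | N
  · simpa using hb
  · simp only [Nat.add_eq_zero_iff, one_ne_zero, and_false, if_false, Nat.add_sub_cancel] at hb
    have h := Nat.choose_succ_right_eq (2 * (N + 1)) N
    rw [show 2 * (N + 1) - N = N + 2 by omega] at h
    nlinarith

/-- Keeps only the paths that are at height `H` at time `t`, stay at or above `H` for `2 * N` steps,
and then return to `0`. -/
theorem le_transfer_three (H N t : ℕ) :
    ∃ b : ℕ, b * (N + 1) = N.centralBinom ∧
      CoeffLE ((b : ℕ[X]) * qNumber (H + 1) ^ N *
        ((transfer qNumber)^[t] (Pi.single H 1) 0 * (transfer qNumber)^[t] (Pi.single 0 1) H))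
        ((transfer qNumber)^[2 * (N + t)] (Pi.single 0 1) 0) := by
  obtain ⟨b, hb, hb'⟩ := exists_catalan_coeffLE H N
  refine ⟨b, hb, ?_⟩
  set r := (transfer qNumber)^[t] (Pi.single 0 1) H
  have h1 : ∀ h, CoeffLE (r * (Pi.single H 1 : ℕ → ℕ[X]) h)
      ((transfer qNumber)^[t] (Pi.single 0 1) h) := coeffLE_mul_single _ (CoeffLE.refl _)
  have h2 : ∀ h, CoeffLE (((b : ℕ[X]) * qNumber (H + 1) ^ N * r) *
      (Pi.single H 1 : ℕ → ℕ[X]) h)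
      ((transfer qNumber)^[2 * N] ((transfer qNumber)^[t] (Pi.single 0 1)) h) := by
    refine coeffLE_mul_single _ (CoeffLE.trans ?_ (CoeffLE.transfer_iterate h1 _ _))
    rw [transfer_iterate_mul, mul_comm]
    exact (CoeffLE.refl _).mul hb'
  have h3 := CoeffLE.transfer_iterate (w := qNumber) h2 t 0
  rw [transfer_iterate_mul, ← Function.iterate_add_apply, ← Function.iterate_add_apply] at h3
  rw [show 2 * (N + t) = t + 2 * N + t by ring]
  convert h3 using 1
  ring

theorem eval_qNumber (q : ℝ) (hq : q ≠ 1) (h : ℕ) :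
    (qNumber h).eval₂ (Nat.castRingHom ℝ) q = (1 - q ^ h) / (1 - q) := by
  rw [qNumber, eval₂_finsetSum]
  simp only [eval₂_X_pow]
  rw [geom_sum_eq hq, ← neg_sub (1 : ℝ), ← neg_sub (1 : ℝ) q, neg_div_neg_eq]

/-- The generating polynomials of the two outer parts of a path, evaluated at `q`. -/
theorem eval_outer (q : ℝ) (hq : q < 1) (H t : ℕ) :
    (1 - q) ^ t * ((transfer qNumber)^[t] (Pi.single H 1) 0 *
      (transfer qNumber)^[t] (Pi.single 0 1) H).eval₂ (Nat.castRingHom ℝ) q =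
    (∏ k ∈ Finset.range H, (1 - q ^ (k + 1))) *
      ((transfer fun h => 1 - q ^ h)^[t] (Pi.single H 1) 0) ^ 2 := by
  -- The q-number of `h` is `(1 - q ^ h) / c ^ 2`. Rescaling both outer parts leaves `c ^ (2 * t)`,
  -- the powers `c ^ H` cancel, and reversal makes both parts the same path sum.
  set c := √(1 - q)
  have hc : 0 < c := Real.sqrt_pos.2 (by linarith)
  have hc2 : c ^ 2 = 1 - q := Real.sq_sqrt (by linarith)
  have hev : ∀ i j, ((transfer qNumber)^[t] (Pi.single i 1) j).eval₂ (Nat.castRingHom ℝ) q =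
      (transfer fun h => (1 - q ^ h) / c ^ 2)^[t] (Pi.single i 1) j := by
    intro i j
    have := map_transfer_iterate (eval₂RingHom (Nat.castRingHom ℝ) q) qNumber (Pi.single i 1) t j
    simp only [coe_eval₂RingHom, eval_qNumber q hq.ne, ← hc2] at this
    have hs : (fun k => ((Pi.single i 1 : ℕ → ℕ[X]) k).eval₂ (Nat.castRingHom ℝ) q) =
        Pi.single i 1 := by
      funext k
      simp only [Pi.single_apply]
      split_ifs <;> simp
    rw [this, hs]
  have hsing : ∀ i : ℕ, (fun j : ℕ => c ^ j * (Pi.single i 1 : ℕ → ℝ) j) =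
      fun j => c ^ i * (Pi.single i 1 : ℕ → ℝ) j := by
    intro i
    funext j
    by_cases h : j = i
    · rw [h]
    · simp [Pi.single_eq_of_ne h]
  have h0 : (fun h => 1 - q ^ h) 0 = 0 := by simp
  have e1 := transfer_iterate_rescale c hc.ne' (fun h => 1 - q ^ h) (Pi.single H 1) h0 t 0
  have e2 := transfer_iterate_rescale c hc.ne' (fun h => 1 - q ^ h) (Pi.single 0 1) h0 t H
  rw [hsing, transfer_iterate_mul] at e1 e2
  have e3 := transfer_symm (fun h => 1 - q ^ h) h0 t H 0
  simp only [Finset.range_zero, Finset.prod_empty, one_mul] at e3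
  rw [eval₂_mul, hev, hev]
  rw [e3] at e2
  have hcH : c ^ H ≠ 0 := by positivity
  apply mul_left_cancel₀ hcH
  rw [← hc2]
  calc _ = (c ^ (0 + t) * (transfer fun h => (1 - q ^ h) / c ^ 2)^[t] (Pi.single H 1) 0) *
      (c ^ (H + t) * (transfer fun h => (1 - q ^ h) / c ^ 2)^[t] (Pi.single 0 1) H) := by ring
    _ = _ := by rw [e1, e2]; ring

/-- The number of diagrams is bounded below by the real weighted path sums. -/
theorem le_card_of_coeff_bound (N t H m : ℕ) (q κ : ℝ) (hq : q < 1)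
    (hm : 2 * (t * (H + t)) ≤ m)
    (hκ : ∀ j ≤ 2 * (t * (H + t)),
      κ * (q ^ j * (1 - q) ^ t) ≤ ((qNumber (H + 1) ^ N).coeff (m - j) : ℝ)) :
    κ * (N.centralBinom / (N + 1)) * ((∏ k ∈ Finset.range H, (1 - q ^ (k + 1))) *
      ((transfer fun h => 1 - q ^ h)^[t] (Pi.single H 1) 0) ^ 2) ≤
    Nat.card {D : ChordDiagram (N + t) // D.crossings = m} := by
  obtain ⟨b, hb, hb'⟩ := le_transfer_three H N t
  have hbr : (N.centralBinom : ℝ) / (N + 1) = b := by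
    rw [div_eq_iff (by positivity)]
    exact_mod_cast hb.symm
  have h1 := (hb' m).trans (ChordDiagram.coeff_transfer_le_card (N + t) m)
  rw [← eval_outer q hq H t, hbr]
  set f := (transfer qNumber)^[t] (Pi.single H 1) 0 * (transfer qNumber)^[t] (Pi.single 0 1) H
  have hdeg : f.natDegree < 2 * (t * (H + t)) + 1 := by
    refine Nat.lt_succ_of_le (natDegree_mul_le.trans ?_)
    have := natDegree_transfer_le H t 0
    have := natDegree_transfer_le 0 t H
    nlinarith
  have h2 : ((((b : ℕ[X]) * qNumber (H + 1) ^ N * f).coeff m : ℕ) : ℝ) =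
      b * ∑ j ∈ Finset.range (m + 1),
        (f.coeff j : ℝ) * ((qNumber (H + 1) ^ N).coeff (m - j) : ℝ) := by
    rw [mul_assoc, coeff_natCast_mul, mul_comm (qNumber (H + 1) ^ N), coeff_mul,
      Finset.Nat.sum_antidiagonal_eq_sum_range_succ
        (fun i j => f.coeff i * (qNumber (H + 1) ^ N).coeff j)]
    push_cast
    rfl
  -- The bound on the middle coefficient is proportional to `q ^ j`, so the convolution with the
  -- outer coefficients becomes their evaluation at `q`.
  calc κ * b * ((1 - q) ^ t * f.eval₂ (Nat.castRingHom ℝ) q)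
      = b * ∑ j ∈ Finset.range (2 * (t * (H + t)) + 1),
        (f.coeff j : ℝ) * (κ * (q ^ j * (1 - q) ^ t)) := by
        rw [eval₂_eq_sum_range' _ hdeg, Finset.mul_sum, Finset.mul_sum, Finset.mul_sum]
        refine Finset.sum_congr rfl fun j _ => ?_
        simp only [eq_natCast]
        ring
    _ ≤ b * ∑ j ∈ Finset.range (2 * (t * (H + t)) + 1),
        (f.coeff j : ℝ) * ((qNumber (H + 1) ^ N).coeff (m - j) : ℝ) := by
        refine mul_le_mul_of_nonneg_left (Finset.sum_le_sum fun j hj => ?_) (Nat.cast_nonneg b)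
        exact mul_le_mul_of_nonneg_left (hκ j (Nat.lt_succ_iff.1 (Finset.mem_range.1 hj)))
          (Nat.cast_nonneg _)
    _ ≤ b * ∑ j ∈ Finset.range (m + 1),
        (f.coeff j : ℝ) * ((qNumber (H + 1) ^ N).coeff (m - j) : ℝ) := by
        refine mul_le_mul_of_nonneg_left ?_ (Nat.cast_nonneg b)
        refine Finset.sum_le_sum_of_subset_of_nonneg
          (Finset.range_subset_range.2 (by omega)) fun _ _ _ => by positivity
    _ ≤ _ := by
        rw [← h2]
        exact_mod_cast h1

theorem sum_multichoose (N M : ℕ) :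
    ∑ j ∈ Finset.range (M + 1), N.multichoose j = (N + 1).multichoose M := by
  induction M with
  | zero => simp
  | succ M ih => rw [Finset.sum_range_succ, ih, Nat.multichoose_succ_succ, add_comm]

theorem sum_multichoose_sub (N M : ℕ) :
    ∑ j ∈ Finset.range (M + 1), N.multichoose (M - j) = (N + 1).multichoose M := by
  rw [← sum_multichoose]
  simpa using Finset.sum_range_reflect (fun j => N.multichoose j) (M + 1)

/-- Bonferroni lower bound for the number of compositions with bounded parts. -/
theorem multichoose_le_coeff_qNumber_pow (g N M : ℕ) :
    N.multichoose M ≤ (qNumber g ^ N).coeff M +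
      if g ≤ M then N * N.multichoose (M - g) else 0 := by
  induction N generalizing M with
  | zero => rcases M with _ | M <;> simp
  | succ N ih =>
    have hc : (qNumber g ^ (N + 1)).coeff M =
        ∑ a ∈ Finset.range g, if a ≤ M then (qNumber g ^ N).coeff (M - a) else 0 := by
      rw [pow_succ', qNumber, Finset.sum_mul, finsetSum_coeff]
      exact Finset.sum_congr rfl fun a _ => coeff_X_pow_mul' _ _ _
    rw [hc, ← sum_multichoose_sub N M]
    by_cases hg : g ≤ M
    · rw [if_pos hg]
      have hsplit : ∑ j ∈ Finset.range (M + 1), N.multichoose (M - j) =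
          ∑ j ∈ Finset.range g, N.multichoose (M - j) + (N + 1).multichoose (M - g) := by
        rw [← sum_multichoose_sub N (M - g), ← Finset.sum_range_add_sum_Ico _ (show g ≤ M + 1 by omega),
          Finset.sum_Ico_eq_sum_range, show M + 1 - g = M - g + 1 by omega]
        congr 1
        exact Finset.sum_congr rfl fun j _ => by rw [Nat.sub_add_eq]
      have hle : ∑ j ∈ Finset.range g, N.multichoose (M - j) ≤
          ∑ j ∈ Finset.range g, ((if j ≤ M then (qNumber g ^ N).coeff (M - j) else 0) +
            if j ∈ Finset.range (M - g + 1) then N * N.multichoose (M - g - j) else 0) := by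
        refine Finset.sum_le_sum fun j hj => ?_
        have hj' := Finset.mem_range.1 hj
        have h := ih (M - j)
        rw [if_pos (show j ≤ M by omega)]
        refine h.trans (Nat.add_le_add_left ?_ _)
        simp only [Finset.mem_range]
        split_ifs with h1 h2
        · rw [Nat.sub_right_comm]
        · omega
        · exact Nat.zero_le _
        · exact le_rfl
      rw [Finset.sum_add_distrib] at hle
      have hle2 : (∑ j ∈ Finset.range g,
          if j ∈ Finset.range (M - g + 1) then N * N.multichoose (M - g - j) else 0) ≤
          N * (N + 1).multichoose (M - g) := by
        rw [← sum_multichoose_sub N (M - g), Finset.mul_sum, ← Finset.sum_filter]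
        exact Finset.sum_le_sum_of_subset fun j hj => (Finset.mem_filter.1 hj).2
      rw [hsplit]
      linarith
    · rw [if_neg hg, add_zero]
      calc _ ≤ ∑ j ∈ Finset.range (M + 1),
            (if j ≤ M then (qNumber g ^ N).coeff (M - j) else 0) := by
            refine Finset.sum_le_sum fun j hj => ?_
            have h := ih (M - j)
            rw [if_neg (by omega), add_zero] at h
            rwa [if_pos (Nat.lt_succ_iff.1 (Finset.mem_range.1 hj))]
        _ ≤ _ := Finset.sum_le_sum_of_subset (Finset.range_subset_range.2 (by omega))

end CoeffLE

/-! ### q-Hermite values and paths reaching height `H` -/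

section Harmonic

variable {q : ℝ}

/-- The finite `q`-Pochhammer symbol `(1 - q) ⋯ (1 - q ^ k)`. -/
noncomputable def qPochhammer (q : ℝ) (k : ℕ) : ℝ := ∏ i ∈ Finset.range k, (1 - q ^ (i + 1))

theorem one_sub_pow_succ_pos (hq0 : 0 < q) (hq1 : q < 1) (i : ℕ) : 0 < 1 - q ^ (i + 1) :=
  sub_pos.2 (pow_lt_one₀ hq0.le hq1 (Nat.succ_ne_zero i))

theorem qPochhammer_pos (hq0 : 0 < q) (hq1 : q < 1) (k : ℕ) : 0 < qPochhammer q k :=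
  Finset.prod_pos fun i _ => one_sub_pow_succ_pos hq0 hq1 i

theorem qPochhammer_succ (q : ℝ) (k : ℕ) :
    qPochhammer q (k + 1) = qPochhammer q k * (1 - q ^ (k + 1)) := Finset.prod_range_succ _ _

theorem qPochhammer_antitone (hq0 : 0 < q) (hq1 : q < 1) : Antitone (qPochhammer q) := by
  refine antitone_nat_of_succ_le fun k => ?_
  rw [qPochhammer_succ]
  refine mul_le_of_le_one_right (qPochhammer_pos hq0 hq1 k).le ?_
  have : 0 ≤ q ^ (k + 1) := by positivity
  linarith

/-- The value at `1` of the continuous `q`-Hermite polynomial, as a function of its degree. -/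
noncomputable def qHermite (q : ℝ) (h : ℕ) : ℝ :=
  qPochhammer q h * ∑ p ∈ Finset.HasAntidiagonal.antidiagonal h, (qPochhammer q p.1)⁻¹ * (qPochhammer q p.2)⁻¹

theorem qHermite_zero : qHermite q 0 = 1 := by simp [qHermite, qPochhammer]

/-- Makes `qHermite` harmonic for the halved transfer operator. It follows from `1 - xy = (1-x) +
(1-y) - (1-x)(1-y)` at `x = q^i`, `y = q^j`, since multiplying the inverse Pochhammer symbol by `1 -
q^k` lowers its index by one. -/
theorem qHermite_recurrence (hq0 : 0 < q) (hq1 : q < 1) (h : ℕ) :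
    qHermite q (h + 1) + (1 - q ^ h) * qHermite q (h - 1) = 2 * qHermite q h := by
  let u : ℕ → ℝ := fun k => (qPochhammer q k)⁻¹
  let a : ℕ → ℝ := fun k => (1 - q ^ k) * u k
  have ha0 : a 0 = 0 := by simp [a]
  have has : ∀ k, a (k + 1) = u k := by
    intro k
    have h1 := (qPochhammer_pos hq0 hq1 k).ne'
    have h2 := (one_sub_pow_succ_pos hq0 hq1 k).ne'
    simp only [a, u, qPochhammer_succ]
    field_simp
  let S : ℕ → ℝ := fun h => ∑ p ∈ Finset.HasAntidiagonal.antidiagonal h, u p.1 * u p.2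
  have hS : ∀ h, qHermite q h = qPochhammer q h * S h := fun h => rfl
  have e1 : ∀ f : ℕ → ℝ, ∀ h, ∑ p ∈ Finset.HasAntidiagonal.antidiagonal (h + 1), a p.1 * f p.2 =
      ∑ p ∈ Finset.HasAntidiagonal.antidiagonal h, u p.1 * f p.2 := by
    intro f h
    rw [Finset.Nat.sum_antidiagonal_succ, ha0, zero_mul, zero_add]
    exact Finset.sum_congr rfl fun p _ => by rw [has]
  have e2 : ∀ f : ℕ → ℝ, ∀ h, ∑ p ∈ Finset.HasAntidiagonal.antidiagonal (h + 1), f p.1 * a p.2 =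
      ∑ p ∈ Finset.HasAntidiagonal.antidiagonal h, f p.1 * u p.2 := by
    intro f h
    rw [Finset.Nat.sum_antidiagonal_succ', ha0, mul_zero, zero_add]
    exact Finset.sum_congr rfl fun p _ => by rw [has]
  have hrec : (1 - q ^ (h + 1)) * S (h + 1) =
      S h + S h - ∑ p ∈ Finset.HasAntidiagonal.antidiagonal h, u p.1 * a p.2 := by
    rw [← e1 a h]
    have h1 := e1 u h
    have h2 := e2 u h
    simp only [S]
    nth_rewrite 2 [← h1]
    rw [← h2, Finset.mul_sum, ← Finset.sum_add_distrib, ← Finset.sum_sub_distrib]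
    refine Finset.sum_congr rfl fun p hp => ?_
    rw [← Finset.HasAntidiagonal.mem_antidiagonal.1 hp]
    simp only [a]
    ring
  rw [hS, hS, hS, qPochhammer_succ, mul_assoc, hrec]
  rcases h with _ | h
  · simp [ha0]
    ring
  · rw [e2 u h, qPochhammer_succ]
    simp only [Nat.add_sub_cancel, S]
    ring

theorem qHermite_le (hq0 : 0 < q) (hq1 : q < 1) {h H : ℕ} (hH : h ≤ H) :
    qHermite q h ≤ (H + 1) / qPochhammer q H := by
  have hpos := qPochhammer_pos hq0 hq1
  have hterm : ∀ p ∈ Finset.HasAntidiagonal.antidiagonal h,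
      qPochhammer q h * ((qPochhammer q p.1)⁻¹ * (qPochhammer q p.2)⁻¹) ≤ (qPochhammer q H)⁻¹ := by
    intro p hp
    have hp' := Finset.HasAntidiagonal.mem_antidiagonal.1 hp
    rw [← mul_assoc]
    have h1 : qPochhammer q h * (qPochhammer q p.1)⁻¹ ≤ 1 := by
      rw [← div_eq_mul_inv, div_le_one (hpos _)]
      exact qPochhammer_antitone hq0 hq1 (by omega)
    have h2 : (qPochhammer q p.2)⁻¹ ≤ (qPochhammer q H)⁻¹ :=
      inv_anti₀ (hpos _) (qPochhammer_antitone hq0 hq1 (by omega))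
    calc _ ≤ 1 * (qPochhammer q p.2)⁻¹ :=
          mul_le_mul_of_nonneg_right h1 (inv_pos.2 (hpos _)).le
      _ ≤ _ := by rwa [one_mul]
  rw [qHermite, Finset.mul_sum]
  refine (Finset.sum_le_card_nsmul _ _ _ hterm).trans ?_
  rw [Finset.Nat.card_antidiagonal, nsmul_eq_mul, div_eq_mul_inv]
  refine mul_le_mul_of_nonneg_right ?_ (inv_pos.2 (hpos _)).le
  exact_mod_cast Nat.succ_le_succ hH

theorem sum_pow_mul_le (hq0 : 0 < q) (hq1 : q < 1) (H r : ℕ) :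
    ∑ i ∈ Finset.range H, (q ^ (i + 1)) ^ (r + 1) ≤ q / (1 - q) / (r + 1) := by
  have hx1 : q ^ (r + 1) < 1 := pow_lt_one₀ hq0.le hq1 (Nat.succ_ne_zero r)
  have hx0 : 0 < q ^ (r + 1) := by positivity
  have h1 : ∑ i ∈ Finset.range H, (q ^ (i + 1)) ^ (r + 1) ≤ q ^ (r + 1) / (1 - q ^ (r + 1)) := by
    have : ∑ i ∈ Finset.range H, (q ^ (i + 1)) ^ (r + 1) =
        q ^ (r + 1) * ∑ i ∈ Finset.range H, (q ^ (r + 1)) ^ i := by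
      rw [Finset.mul_sum]
      refine Finset.sum_congr rfl fun i _ => ?_
      rw [← pow_mul, ← pow_mul, ← pow_add]
      ring_nf
    rw [this, div_eq_mul_inv]
    refine mul_le_mul_of_nonneg_left ?_ hx0.le
    rw [← tsum_geometric_of_lt_one hx0.le hx1]
    exact (summable_geometric_of_lt_one hx0.le hx1).sum_le_tsum _ fun i _ => by positivity
  refine h1.trans ?_
  have h2 : (r + 1) * q ^ r * (1 - q) ≤ 1 - q ^ (r + 1) := by
    rw [← mul_neg_geom_sum q (r + 1), mul_comm]
    refine mul_le_mul_of_nonneg_left ?_ (by linarith)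
    have := Finset.card_nsmul_le_sum (Finset.range (r + 1)) (fun i => q ^ i) (q ^ r) fun i hi =>
      pow_le_pow_of_le_one hq0.le hq1.le (Nat.lt_succ_iff.1 (Finset.mem_range.1 hi))
    rw [Finset.card_range, nsmul_eq_mul] at this
    exact_mod_cast this
  have h3 : 0 < 1 - q := by linarith
  rw [div_div, div_le_div_iff₀ (by linarith) (by positivity)]
  calc _ = q * ((r + 1) * q ^ r * (1 - q)) := by ring
    _ ≤ _ := mul_le_mul_of_nonneg_left h2 hq0.le

/-- Expanding each `-log (1 - q^i)` and summing over `i` first bounds the `r`-th term by `q / (1-q)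
/ r²`; the sum is `ζ(2)`, the source of `π²`. -/
theorem exp_le_qPochhammer (hq0 : 0 < q) (hq1 : q < 1) (H : ℕ) :
    Real.exp (-(q / (1 - q) * (Real.pi ^ 2 / 6))) ≤ qPochhammer q H := by
  rw [← Real.le_log_iff_exp_le (qPochhammer_pos hq0 hq1 H), qPochhammer,
    Real.log_prod fun i _ => (one_sub_pow_succ_pos hq0 hq1 i).ne']
  have h1 : HasSum (fun r : ℕ => ∑ i ∈ Finset.range H, (q ^ (i + 1)) ^ (r + 1) / ((r : ℝ) + 1))
      (∑ i ∈ Finset.range H, -Real.log (1 - q ^ (i + 1))) := by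
    refine hasSum_sum fun i _ => Real.hasSum_pow_div_log_of_abs_lt_one ?_
    rw [abs_of_pos (by positivity)]
    exact pow_lt_one₀ hq0.le hq1 (Nat.succ_ne_zero i)
  have h2 : HasSum (fun r : ℕ => q / (1 - q) * (1 / ((r + 1 : ℕ) : ℝ) ^ 2))
      (q / (1 - q) * (Real.pi ^ 2 / 6)) := by
    refine HasSum.mul_left _ ?_
    have := (hasSum_nat_add_iff' (f := fun n : ℕ => 1 / (n : ℝ) ^ 2) 1).2 hasSum_zeta_two
    simpa using this
  have h3 := hasSum_le (fun r => ?_) h1 h2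
  · rw [Finset.sum_neg_distrib] at h3
    linarith
  · rw [← Finset.sum_div, div_le_iff₀ (by positivity)]
    refine (sum_pow_mul_le hq0 hq1 H r).trans (le_of_eq ?_)
    push_cast
    field_simp

theorem transfer_iterate_nonneg {w f : ℕ → ℝ} (hw : ∀ h, 0 ≤ w h) (hf : ∀ h, 0 ≤ f h) (t h : ℕ) :
    0 ≤ (transfer w)^[t] f h := by
  induction t generalizing h with
  | zero => exact hf h
  | succ t ih =>
    rw [transfer_iterate_succ]
    exact add_nonneg (ih _) (mul_nonneg (hw _) (ih _))

/-- A bound for the harmonic function by stopping the path when it reaches height `H`. -/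
theorem qHermite_le_stopped (hq0 : 0 < q) (hq1 : q < 1) (H s h : ℕ) (hH : h ≤ H) :
    qHermite q h ≤ (H + 1) / qPochhammer q H *
      (∑ t ∈ Finset.range (s + 1), (1 / 2) ^ t *
        (transfer fun h => 1 - q ^ h)^[t] (Pi.single H 1) h +
        (1 - 1 / (2 * (H + 1) ^ 2)) ^ s * (2 * (H + 1) ^ 2 - h ^ 2)) := by
  have hM : 0 < (H + 1) / qPochhammer q H := by
    have := qPochhammer_pos hq0 hq1 H
    positivity
  set M := (H + 1) / qPochhammer q H
  set w : ℕ → ℝ := fun h => 1 - q ^ h with hw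
  have hw0 : ∀ h, 0 ≤ w h := fun h => sub_nonneg.2 (pow_le_one₀ hq0.le hq1.le)
  have hw1 : ∀ h, w h ≤ 1 := fun h => sub_le_self _ (by positivity)
  have hn : ∀ t h, 0 ≤ (transfer w)^[t] (Pi.single H 1) h :=
    transfer_iterate_nonneg hw0 fun h => by
      by_cases e : h = H
      · subst e; simp
      · simp [Pi.single_eq_of_ne e]
  have hH1 : (1 : ℝ) ≤ (H + 1) ^ 2 := by nlinarith [(Nat.cast_nonneg H : (0 : ℝ) ≤ H)]
  set θ : ℝ := 1 - 1 / (2 * (H + 1) ^ 2) with hθ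
  have hθ0 : 0 ≤ θ := by
    rw [hθ, sub_nonneg, div_le_one (by positivity)]
    linarith
  have hg : ∀ h : ℕ, h ≤ H → (1 : ℝ) ≤ 2 * (H + 1) ^ 2 - h ^ 2 := by
    intro h hh
    have h1 : (h : ℝ) ≤ H := by exact_mod_cast hh
    have h2 : (0 : ℝ) ≤ h := Nat.cast_nonneg h
    nlinarith
  induction s generalizing h with
  | zero =>
    refine (qHermite_le hq0 hq1 hH).trans (le_mul_of_one_le_right hM.le ?_)
    have h1 := hg h hH
    have h2 := hn 0 h
    simp only [zero_add, Finset.sum_range_one, pow_zero, one_mul]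
    linarith
  | succ s ih =>
    rw [Finset.sum_range_succ']
    rcases hH.lt_or_eq with hlt | rfl
    · have hstep : ∑ t ∈ Finset.range (s + 1), (1 / 2 : ℝ) ^ (t + 1) *
          (transfer w)^[t + 1] (Pi.single H 1) h = 1 / 2 *
          (∑ t ∈ Finset.range (s + 1), (1 / 2) ^ t * (transfer w)^[t] (Pi.single H 1) (h + 1) +
          w h * ∑ t ∈ Finset.range (s + 1), (1 / 2) ^ t *
            (transfer w)^[t] (Pi.single H 1) (h - 1)) := by
        rw [Finset.mul_sum (a := w h), ← Finset.sum_add_distrib, Finset.mul_sum]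
        refine Finset.sum_congr rfl fun t _ => ?_
        rw [transfer_iterate_succ]
        ring
      have i1 := ih (h + 1) hlt
      have i2 := mul_le_mul_of_nonneg_left (ih (h - 1) (by omega)) (hw0 h)
      have hrec := qHermite_recurrence hq0 hq1 h
      -- The function `2(H+1)² - h²` drops by at least `1` under averaging and is at most `2(H+1)²`,
      -- so it contracts by the factor `θ`; this bounds the paths that have not reached `H`.
      have hε : 1 / 2 * ((2 * (H + 1) ^ 2 - ((h + 1 : ℕ) : ℝ) ^ 2) +
          w h * (2 * (H + 1) ^ 2 - ((h - 1 : ℕ) : ℝ) ^ 2)) ≤ θ * (2 * (H + 1) ^ 2 - (h : ℝ) ^ 2) := by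
        have hd : θ * (2 * (H + 1) ^ 2 - (h : ℝ) ^ 2) ≥ (2 * (H + 1) ^ 2 - (h : ℝ) ^ 2) - 1 := by
          have : 1 / (2 * ((H : ℝ) + 1) ^ 2) * (2 * (H + 1) ^ 2 - (h : ℝ) ^ 2) ≤ 1 := by
            rw [div_mul_eq_mul_div, one_mul, div_le_one (by positivity)]
            nlinarith [sq_nonneg (h : ℝ)]
          rw [hθ]
          linarith
        refine le_trans ?_ hd
        rcases h with _ | h
        · simp only [hw, pow_zero, sub_self, zero_mul]
          push_cast
          linarith
        · have h1 := hg h (by omega)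
          have h2 := mul_le_of_le_one_left (zero_le_one.trans h1) (hw1 (h + 1))
          simp only [Nat.add_sub_cancel]
          push_cast
          linarith
      have hθs : 0 ≤ θ ^ s := pow_nonneg hθ0 s
      have hε' := mul_le_mul_of_nonneg_left hε hθs
      simp only [hw] at hstep i2 hε' ⊢
      rw [hstep]
      have hz := hn 0 h
      simp only [hw] at hz
      have hkey : qHermite q h ≤ M * (1 / 2 *
          (∑ t ∈ Finset.range (s + 1), (1 / 2) ^ t *
            (transfer fun h => 1 - q ^ h)^[t] (Pi.single H 1) (h + 1) +
          (1 - q ^ h) * ∑ t ∈ Finset.range (s + 1), (1 / 2) ^ t *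
            (transfer fun h => 1 - q ^ h)^[t] (Pi.single H 1) (h - 1)) +
          θ ^ s * (1 / 2 * ((2 * (H + 1) ^ 2 - ((h + 1 : ℕ) : ℝ) ^ 2) +
            (1 - q ^ h) * (2 * (H + 1) ^ 2 - ((h - 1 : ℕ) : ℝ) ^ 2)))) := by
        linarith
      refine hkey.trans (mul_le_mul_of_nonneg_left ?_ hM.le)
      rw [pow_succ θ]
      simp only [pow_zero, one_mul]
      linarith
    · refine (qHermite_le hq0 hq1 le_rfl).trans (le_mul_of_one_le_right hM.le ?_)
      have h1 : 0 ≤ ∑ t ∈ Finset.range (s + 1), (1 / 2 : ℝ) ^ (t + 1) *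
          (transfer w)^[t + 1] (Pi.single h 1) h :=
        Finset.sum_nonneg fun t _ => mul_nonneg (by positivity) (hn _ _)
      have h2 : 0 ≤ θ ^ (s + 1) * (2 * ((h : ℝ) + 1) ^ 2 - (h : ℝ) ^ 2) :=
        mul_nonneg (pow_nonneg hθ0 _) (zero_le_one.trans (hg h le_rfl))
      simp only [pow_zero, one_mul, Function.iterate_zero, id, Pi.single_eq_same]
      linarith

/-- The harmonic function is `1` at height `0`, and `hs` makes the unstopped part at most `1/2`, so
some of the `s + 1` times carries an average share. Squaring that share and multiplying by
`qPochhammer q H` gives a cube, hence `π²/2 = 3 * π²/6`. -/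
theorem exists_transfer_ge (hq0 : 0 < q) (hq1 : q < 1) (H s : ℕ)
    (hs : 4 * (H + 1) ^ 3 * Real.exp (q / (1 - q) * (Real.pi ^ 2 / 6)) *
      Real.exp (-(s / (2 * (H + 1) ^ 2))) ≤ 1) :
    ∃ t ≤ s, 4 ^ t * Real.exp (-(q / (1 - q) * (Real.pi ^ 2 / 2))) /
        (4 * (H + 1) ^ 2 * (s + 1) ^ 2) ≤
      qPochhammer q H * ((transfer fun h => 1 - q ^ h)^[t] (Pi.single H 1) 0) ^ 2 := by
  have hP := qPochhammer_pos hq0 hq1 H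
  have hPe := exp_le_qPochhammer hq0 hq1 H
  set E := q / (1 - q) * (Real.pi ^ 2 / 6) with hE
  have hst := qHermite_le_stopped hq0 hq1 H s 0 (Nat.zero_le _)
  rw [qHermite_zero] at hst
  have hH1 : (1 : ℝ) ≤ (H + 1) ^ 2 := by nlinarith [(Nat.cast_nonneg H : (0 : ℝ) ≤ H)]
  have hθ : (1 - 1 / (2 * ((H : ℝ) + 1) ^ 2)) ^ s ≤ Real.exp (-(s / (2 * (H + 1) ^ 2))) := by
    have h1 : 1 - 1 / (2 * ((H : ℝ) + 1) ^ 2) ≤ Real.exp (-(1 / (2 * (H + 1) ^ 2))) :=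
      Real.one_sub_le_exp_neg _
    have h0 : 0 ≤ 1 - 1 / (2 * ((H : ℝ) + 1) ^ 2) := by
      rw [sub_nonneg, div_le_one (by positivity)]
      linarith
    refine (pow_le_pow_left₀ h0 h1 s).trans (le_of_eq ?_)
    rw [← Real.exp_nat_mul]
    congr 1
    ring
  have hinv : 1 / qPochhammer q H ≤ Real.exp E := by
    rw [div_le_iff₀ hP]
    calc (1 : ℝ) = Real.exp E * Real.exp (-E) := by rw [← Real.exp_add]; simp
      _ ≤ _ := mul_le_mul_of_nonneg_left hPe (Real.exp_pos _).le
  have hsmall : (H + 1) / qPochhammer q H * ((1 - 1 / (2 * ((H : ℝ) + 1) ^ 2)) ^ s *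
      (2 * (H + 1) ^ 2)) ≤ 1 / 2 := by
    have h1 : ((H : ℝ) + 1) / qPochhammer q H ≤ (H + 1) * Real.exp E := by
      rw [← mul_one_div]
      exact mul_le_mul_of_nonneg_left hinv (by positivity)
    calc _ ≤ (H + 1) * Real.exp E * (Real.exp (-(s / (2 * (H + 1) ^ 2))) * (2 * (H + 1) ^ 2)) := by
          refine mul_le_mul h1 (mul_le_mul_of_nonneg_right hθ (by positivity)) ?_ (by positivity)
          refine mul_nonneg (pow_nonneg ?_ _) (by positivity)
          rw [sub_nonneg, div_le_one (by positivity)]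
          linarith
      _ = 1 / 2 * (4 * (H + 1) ^ 3 * Real.exp E * Real.exp (-(s / (2 * (H + 1) ^ 2)))) := by ring
      _ ≤ 1 / 2 := by linarith
  set A : ℕ → ℝ := fun t => (transfer fun h => 1 - q ^ h)^[t] (Pi.single H 1) 0 with hA
  have hsum : qPochhammer q H / (2 * (H + 1)) ≤ ∑ t ∈ Finset.range (s + 1), (1 / 2) ^ t * A t := by
    rw [div_le_iff₀ (by positivity)]
    have h1 : 1 / 2 ≤ (H + 1) / qPochhammer q H *
        ∑ t ∈ Finset.range (s + 1), (1 / 2) ^ t * A t := by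
      rw [mul_add] at hst
      simp only [Nat.cast_zero, ne_eq, OfNat.ofNat_ne_zero, not_false_eq_true, zero_pow,
        sub_zero] at hst
      linarith
    rw [div_mul_eq_mul_div, le_div_iff₀ hP] at h1
    linarith
  obtain ⟨t, ht, hle⟩ : ∃ t ∈ Finset.range (s + 1),
      qPochhammer q H / (2 * (H + 1)) / (s + 1) ≤ (1 / 2) ^ t * A t := by
    refine Finset.exists_le_of_sum_le (by simp) ?_
    rw [Finset.sum_const, Finset.card_range, nsmul_eq_mul]
    refine le_trans (le_of_eq ?_) hsum
    push_cast
    field_simp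
  refine ⟨t, Nat.lt_succ_iff.1 (Finset.mem_range.1 ht), ?_⟩
  have hsq := pow_le_pow_left₀ (by positivity) hle 2
  have hcube : Real.exp (-(q / (1 - q) * (Real.pi ^ 2 / 2))) ≤ qPochhammer q H ^ 3 := by
    refine le_trans (le_of_eq ?_) (pow_le_pow_left₀ (Real.exp_pos _).le hPe 3)
    rw [← Real.exp_nat_mul, hE]
    congr 1
    push_cast
    ring
  have h4 : (4 : ℝ) ^ t * ((1 / 2) ^ t * A t) ^ 2 = A t ^ 2 := by
    rw [mul_pow, ← pow_mul, mul_comm t 2, pow_mul, ← mul_assoc, ← mul_pow]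
    norm_num
  calc _ ≤ 4 ^ t * qPochhammer q H ^ 3 / (4 * (H + 1) ^ 2 * (s + 1) ^ 2) := by
        gcongr
    _ = qPochhammer q H * (4 ^ t * (qPochhammer q H / (2 * (H + 1)) / (s + 1)) ^ 2) := by
        field_simp
        ring
    _ ≤ qPochhammer q H * (4 ^ t * ((1 / 2) ^ t * A t) ^ 2) := by gcongr
    _ = _ := by rw [h4]

end Harmonic

/-! ### Ratios and bounds for multiset coefficients -/

section Multichoose

theorem succ_mul_multichoose_succ (n M : ℕ) :
    (M + 1) * n.multichoose (M + 1) = (n + M) * n.multichoose M := by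
  rcases Nat.eq_zero_or_pos (n + M) with h | h
  · obtain ⟨rfl, rfl⟩ : n = 0 ∧ M = 0 := by omega
    simp
  · rw [Nat.multichoose_eq, Nat.multichoose_eq, ← Nat.add_assoc, Nat.add_sub_cancel]
    obtain ⟨N, hN⟩ : ∃ N, n + M = N + 1 := ⟨n + M - 1, by omega⟩
    rw [hN, Nat.add_sub_cancel, Nat.add_one_mul_choose_eq, mul_comm]

theorem mul_multichoose_succ_left (n M : ℕ) :
    n * (n + 1).multichoose M = (n + M) * n.multichoose M := by
  rcases Nat.eq_zero_or_pos (n + M) with h | h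
  · obtain ⟨rfl, rfl⟩ : n = 0 ∧ M = 0 := by omega
    simp
  · rw [Nat.multichoose_eq, Nat.multichoose_eq, Nat.add_right_comm, Nat.add_sub_cancel]
    obtain ⟨N, hN⟩ : ∃ N, n + M = N + 1 := ⟨n + M - 1, by omega⟩
    have h1 := Nat.choose_mul_succ_eq N M
    rw [show N + 1 - M = n by omega] at h1
    rw [hN, Nat.add_sub_cancel, mul_comm n, ← h1, mul_comm]

/-- Removing one part multiplies by `N / (N + m)`, with `N` the remaining number of parts; here `n -
t ≤ N ≤ n`. -/
theorem multichoose_mul_le_sub_left (n m t : ℕ) (ht : t ≤ n) (hn : 0 < n) :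
    (n.multichoose m : ℝ) * (((n : ℝ) - t) / (m + n)) ^ t ≤ ((n - t).multichoose m : ℝ) := by
  have hgen : ∀ i ≤ t, (n.multichoose m : ℝ) * (((n : ℝ) - t) / (m + n)) ^ i ≤
      ((n - i).multichoose m : ℝ) := by
    intro i
    induction i with
    | zero => simp
    | succ i ih =>
      intro hi
      have h := ih (by omega)
      have hid := mul_multichoose_succ_left (n - (i + 1)) m
      rw [show n - (i + 1) + 1 = n - i by omega] at hid
      have hid' : ((n - (i + 1) : ℕ) : ℝ) * ((n - i).multichoose m : ℝ) =
          (((n - (i + 1) : ℕ) : ℝ) + m) * ((n - (i + 1)).multichoose m : ℝ) := by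
        exact_mod_cast hid
      have hnpos : (0 : ℝ) < m + n := by positivity
      have hti : (n : ℝ) - t ≤ ((n - (i + 1) : ℕ) : ℝ) := by
        rw [Nat.cast_sub (by omega)]
        have : ((i + 1 : ℕ) : ℝ) ≤ t := by exact_mod_cast hi
        linarith
      have h0 : 0 ≤ ((n : ℝ) - t) / (m + n) := by
        have : (t : ℝ) ≤ n := by exact_mod_cast ht
        exact div_nonneg (by linarith) hnpos.le
      have hle : (((n - (i + 1) : ℕ) : ℝ) + m) ≤ m + n := by
        have : ((n - (i + 1) : ℕ) : ℝ) ≤ n := by exact_mod_cast Nat.sub_le _ _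
        linarith
      rw [pow_succ, ← mul_assoc]
      refine (mul_le_mul_of_nonneg_right h h0).trans ?_
      rw [← mul_div_assoc, div_le_iff₀ hnpos]
      calc _ ≤ ((n - i).multichoose m : ℝ) * ((n - (i + 1) : ℕ) : ℝ) :=
            mul_le_mul_of_nonneg_left hti (Nat.cast_nonneg _)
        _ = ((n - (i + 1)).multichoose m : ℝ) * (((n - (i + 1) : ℕ) : ℝ) + m) := by
            rw [mul_comm, hid', mul_comm]
        _ ≤ _ := mul_le_mul_of_nonneg_left hle (Nat.cast_nonneg _)
  exact hgen t le_rfl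

theorem multichoose_mul_le_sub_right (n m j : ℕ) (hj : j ≤ m) (hn : 0 < n) :
    (n.multichoose m : ℝ) * (((m : ℝ) - j) / (m + n)) ^ j ≤ (n.multichoose (m - j) : ℝ) := by
  have hgen : ∀ i ≤ j, (n.multichoose m : ℝ) * (((m : ℝ) - j) / (m + n)) ^ i ≤
      (n.multichoose (m - i) : ℝ) := by
    intro i
    induction i with
    | zero => simp
    | succ i ih =>
      intro hi
      have h := ih (by omega)
      have hid := succ_mul_multichoose_succ n (m - (i + 1))
      rw [show m - (i + 1) + 1 = m - i by omega] at hid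
      have hid' : ((m - i : ℕ) : ℝ) * (n.multichoose (m - i) : ℝ) =
          ((n : ℝ) + ((m - (i + 1) : ℕ) : ℝ)) * (n.multichoose (m - (i + 1)) : ℝ) := by
        exact_mod_cast hid
      have hnpos : (0 : ℝ) < m + n := by positivity
      have hti : (m : ℝ) - j ≤ ((m - i : ℕ) : ℝ) := by
        rw [Nat.cast_sub (by omega)]
        have : (i : ℝ) ≤ j := by exact_mod_cast (Nat.le_of_succ_le hi)
        linarith
      have h0 : 0 ≤ ((m : ℝ) - j) / (m + n) := by
        have : (j : ℝ) ≤ m := by exact_mod_cast hj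
        exact div_nonneg (by linarith) hnpos.le
      have hle : ((n : ℝ) + ((m - (i + 1) : ℕ) : ℝ)) ≤ m + n := by
        have : ((m - (i + 1) : ℕ) : ℝ) ≤ m := by exact_mod_cast Nat.sub_le _ _
        linarith
      rw [pow_succ, ← mul_assoc]
      refine (mul_le_mul_of_nonneg_right h h0).trans ?_
      rw [← mul_div_assoc, div_le_iff₀ hnpos]
      calc _ ≤ (n.multichoose (m - i) : ℝ) * ((m - i : ℕ) : ℝ) :=
            mul_le_mul_of_nonneg_left hti (Nat.cast_nonneg _)
        _ = (n.multichoose (m - (i + 1)) : ℝ) * ((n : ℝ) + ((m - (i + 1) : ℕ) : ℝ)) := by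
            rw [mul_comm, hid', mul_comm]
        _ ≤ _ := mul_le_mul_of_nonneg_left hle (Nat.cast_nonneg _)
  exact hgen j le_rfl

theorem multichoose_sub_left_le (n m k : ℕ) (hk : k ≤ n) (hm : 0 < m) :
    ((n - k).multichoose m : ℝ) ≤ (n.multichoose m : ℝ) * ((n : ℝ) / (m + n)) ^ k := by
  induction k with
  | zero => simp
  | succ k ih =>
    have h := ih (by omega)
    have hid := mul_multichoose_succ_left (n - (k + 1)) m
    rw [show n - (k + 1) + 1 = n - k by omega] at hid
    set N := n - (k + 1) with hN
    have hid' : (N : ℝ) * ((n - k).multichoose m : ℝ) = ((N : ℝ) + m) * (N.multichoose m : ℝ) := by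
      exact_mod_cast hid
    have hNm : (0 : ℝ) < (N : ℝ) + m := by positivity
    have hnm : (0 : ℝ) < (m : ℝ) + n := by positivity
    have hNn : (N : ℝ) ≤ n := by exact_mod_cast Nat.sub_le _ _
    have hfrac : (N : ℝ) / (N + m) ≤ n / (m + n) := by
      rw [div_le_div_iff₀ hNm hnm]
      nlinarith [(Nat.cast_nonneg m : (0 : ℝ) ≤ m)]
    have heq : (N.multichoose m : ℝ) = ((n - k).multichoose m : ℝ) * (N / (N + m)) := by
      field_simp
      linarith
    rw [heq, pow_succ, ← mul_assoc]
    exact mul_le_mul h hfrac (by positivity) (by positivity)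

theorem multichoose_sub_right_le (N m M g : ℕ) (hg : g ≤ M) (hM : M ≤ m) (hN : 1 < N) :
    (N.multichoose (M - g) : ℝ) ≤ (N.multichoose M : ℝ) * ((m : ℝ) / ((N : ℝ) - 1 + m)) ^ g := by
  induction g with
  | zero => simp
  | succ g ih =>
    have h := ih (by omega)
    have hid := succ_mul_multichoose_succ N (M - (g + 1))
    rw [show M - (g + 1) + 1 = M - g by omega] at hid
    obtain ⟨x, hx⟩ : ∃ x, M - g = x + 1 := ⟨M - g - 1, by omega⟩
    have hx' : M - (g + 1) = x := by omega
    rw [hx, hx'] at hid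
    rw [hx'] at *
    rw [hx] at h
    have hid' : ((x : ℝ) + 1) * (N.multichoose (x + 1) : ℝ) =
        ((N : ℝ) + x) * (N.multichoose x : ℝ) := by exact_mod_cast hid
    have hN1 : (1 : ℝ) < N := by exact_mod_cast hN
    have hxm : (x : ℝ) + 1 ≤ m := by
      have : x + 1 ≤ m := by omega
      exact_mod_cast this
    have hx0 : (0 : ℝ) ≤ x := Nat.cast_nonneg x
    have h1 : (0 : ℝ) < (N : ℝ) + x := by linarith
    have h2 : (0 : ℝ) < (N : ℝ) - 1 + m := by linarith
    have hfrac : ((x : ℝ) + 1) / (N + x) ≤ m / (N - 1 + m) := by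
      rw [div_le_div_iff₀ h1 h2]
      nlinarith
    have heq : (N.multichoose x : ℝ) = (N.multichoose (x + 1) : ℝ) * ((x + 1) / (N + x)) := by
      field_simp
      linarith
    rw [heq, pow_succ, ← mul_assoc]
    exact mul_le_mul h hfrac (by positivity) (by positivity)

theorem multichoose_mono_right {N a b : ℕ} (hN : 0 < N) (hab : a ≤ b) :
    N.multichoose a ≤ N.multichoose b := by
  obtain ⟨N, rfl⟩ : ∃ K, N = K + 1 := ⟨N - 1, by omega⟩
  rw [← sum_multichoose, ← sum_multichoose]
  exact Finset.sum_le_sum_of_subset (Finset.range_subset_range.2 (by omega))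

/-- This is `choose (k + x) k ≤ (k + x)^k / k!` combined with `k^k / k! ≤ e^k`. -/
theorem multichoose_succ_le (k x : ℕ) (hk : 0 < k) :
    ((k + 1).multichoose x : ℝ) ≤ (Real.exp 1 * (((x : ℝ) + k) / k)) ^ k := by
  rw [Nat.multichoose_eq, Nat.add_right_comm, Nat.add_sub_cancel, Nat.choose_symm_add.symm]
  have h1 : ((k + x).choose k : ℝ) ≤ ((k + x : ℕ) : ℝ) ^ k / (k.factorial : ℝ) :=
    Nat.choose_le_pow_div k (k + x)
  have h2 : (k : ℝ) ^ k / k.factorial ≤ Real.exp k :=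
    Real.pow_div_factorial_le_exp k (Nat.cast_nonneg k) k
  have hk' : (0 : ℝ) < k := by exact_mod_cast hk
  refine h1.trans ?_
  have e1 : Real.exp (k : ℝ) = Real.exp 1 ^ k := by
    rw [← Real.exp_nat_mul, mul_one]
  rw [mul_pow, div_pow, ← e1]
  calc _ = ((x : ℝ) + k) ^ k / (k : ℝ) ^ k * ((k : ℝ) ^ k / k.factorial) := by
        push_cast
        rw [add_comm (x : ℝ)]
        field_simp
    _ ≤ ((x : ℝ) + k) ^ k / (k : ℝ) ^ k * Real.exp k :=
        mul_le_mul_of_nonneg_left h2 (by positivity)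
    _ = _ := mul_comm _ _

end Multichoose

/-! ### Coefficients of q-number powers near the saddle point -/

section LowerBound

theorem half_le_one_sub_div_pow {x : ℝ} {j : ℕ} (hx : 0 < x) (hj : 2 * (j : ℝ) ^ 2 ≤ x) :
    1 / 2 ≤ (1 - j / x) ^ j := by
  rcases Nat.eq_zero_or_pos j with rfl | hj0
  · norm_num
  have hj1 : (1 : ℝ) ≤ j := by exact_mod_cast hj0
  have hjx : (j : ℝ) / x ≤ 1 := by
    rw [div_le_one hx]
    nlinarith
  have := one_add_mul_le_pow (a := -((j : ℝ) / x)) (by linarith) j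
  have h2 : (j : ℝ) * (j / x) ≤ 1 / 2 := by
    rw [← mul_div_assoc, div_le_iff₀ hx]
    nlinarith
  rw [← sub_eq_add_neg] at this
  nlinarith

/-- Most compositions have small parts, and the numbers of compositions with nearby parameters are
comparable. -/
theorem multichoose_le_coeff {n m t j H : ℕ} (ht : t < n) (hnm : n ≤ m)
    (ht2 : 2 * (t : ℝ) ^ 2 ≤ n) (hj2 : 2 * (j : ℝ) ^ 2 ≤ m) (hjm : j ≤ m) (hN : 1 < n - t)
    (htail : ((n - t : ℕ) : ℝ) * ((m : ℝ) / (((n - t : ℕ) : ℝ) - 1 + m)) ^ (H + 1) ≤ 1 / 2) :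
    (n.multichoose m : ℝ) / 8 * (((m : ℝ) / (m + n)) ^ j * (1 - (m : ℝ) / (m + n)) ^ t) ≤
      ((qNumber (H + 1) ^ (n - t)).coeff (m - j) : ℝ) := by
  set N := n - t with hNdef
  have hn : 0 < n := by omega
  have hnr : (0 : ℝ) < n := by exact_mod_cast hn
  have hmr : (0 : ℝ) < m := by exact_mod_cast hn.trans_le hnm
  have h1 := multichoose_mul_le_sub_left n m t ht.le hn
  have h2 := multichoose_mul_le_sub_right N m j hjm (by omega)
  have hNn : (N : ℝ) ≤ n := by exact_mod_cast Nat.sub_le _ _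
  have hjr : (j : ℝ) ≤ m := by exact_mod_cast hjm
  have htr : (t : ℝ) ≤ n := by exact_mod_cast ht.le
  have h3 : (N.multichoose m : ℝ) * (((m : ℝ) - j) / (m + n)) ^ j ≤ N.multichoose (m - j) := by
    refine le_trans ?_ h2
    have : ((m : ℝ) - j) / (m + n) ≤ ((m : ℝ) - j) / (m + N) :=
      div_le_div_of_nonneg_left (by linarith) (by positivity) (by linarith)
    exact mul_le_mul_of_nonneg_left (pow_le_pow_left₀ (div_nonneg (by linarith) (by positivity))
      this j) (Nat.cast_nonneg _)
  have e1 : ((n : ℝ) - t) / (m + n) = (1 - (m : ℝ) / (m + n)) * (1 - t / n) := by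
    field_simp
    ring
  have e2 : ((m : ℝ) - j) / (m + n) = (m : ℝ) / (m + n) * (1 - j / m) := by
    field_simp
  rw [e1, mul_pow] at h1
  rw [e2, mul_pow] at h3
  have i1 := half_le_one_sub_div_pow hnr ht2
  have i2 := half_le_one_sub_div_pow hmr hj2
  set q : ℝ := (m : ℝ) / (m + n)
  have hq0 : 0 ≤ q := by positivity
  have hq1 : 0 ≤ 1 - q := by
    have : q ≤ 1 := (div_le_one (by positivity)).2 (by linarith)
    linarith
  -- Removing `t` parts and lowering the sum by `j` each cost a factor `1/2`; compositions with a
  -- part above `H` cost the last one, giving `1/8`.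
  have hA : (n.multichoose m : ℝ) / 4 * (q ^ j * (1 - q) ^ t) ≤ N.multichoose (m - j) := by
    have j1 : (n.multichoose m : ℝ) * ((1 - q) ^ t * (1 / 2)) ≤ N.multichoose m :=
      le_trans (mul_le_mul_of_nonneg_left
        (mul_le_mul_of_nonneg_left i1 (pow_nonneg hq1 t)) (Nat.cast_nonneg _)) h1
    have j2 : (N.multichoose m : ℝ) * (q ^ j * (1 / 2)) ≤ N.multichoose (m - j) :=
      le_trans (mul_le_mul_of_nonneg_left
        (mul_le_mul_of_nonneg_left i2 (pow_nonneg hq0 j)) (Nat.cast_nonneg _)) h3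
    refine le_trans ?_ j2
    calc _ = (n.multichoose m : ℝ) * ((1 - q) ^ t * (1 / 2)) * (q ^ j * (1 / 2)) := by ring
      _ ≤ _ := mul_le_mul_of_nonneg_right j1 (by positivity)
  have hB := multichoose_le_coeff_qNumber_pow (H + 1) N (m - j)
  have hB' : (N.multichoose (m - j) : ℝ) ≤ ((qNumber (H + 1) ^ N).coeff (m - j) : ℝ) +
      (N.multichoose (m - j) : ℝ) * (1 / 2) := by
    split_ifs at hB with hle
    · have h4 := multichoose_sub_right_le N m (m - j) (H + 1) hle (Nat.sub_le _ _) hN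
      have h5 : (N.multichoose (m - j) : ℝ) ≤ ((qNumber (H + 1) ^ N).coeff (m - j) : ℝ) +
        N * N.multichoose (m - j - (H + 1)) := by exact_mod_cast hB
      refine h5.trans (add_le_add le_rfl ?_)
      calc _ ≤ (N : ℝ) * ((N.multichoose (m - j) : ℝ) *
            ((m : ℝ) / ((N : ℝ) - 1 + m)) ^ (H + 1)) :=
            mul_le_mul_of_nonneg_left h4 (Nat.cast_nonneg _)
        _ = (N.multichoose (m - j) : ℝ) * (N * ((m : ℝ) / ((N : ℝ) - 1 + m)) ^ (H + 1)) := by ring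
        _ ≤ _ := mul_le_mul_of_nonneg_left htail (Nat.cast_nonneg _)
    · have h5 : (N.multichoose (m - j) : ℝ) ≤ ((qNumber (H + 1) ^ N).coeff (m - j) : ℝ) := by
        exact_mod_cast hB
      have : (0 : ℝ) ≤ N.multichoose (m - j) := Nat.cast_nonneg _
      linarith
  linarith

/-- The base is at most `exp(-1/(2L))`, because `m ≤ n * L / 2`; raised to a power above `4L²` it is
at most `exp(-2L) = n^(-2)`. -/
theorem tail_le_half {n m t H : ℕ} {L : ℝ} (hL : 1 ≤ L) (hn : Real.exp L = n)
    (ht : 2 * ((t : ℝ) + 1) ≤ n) (htn : t ≤ n) (hm : (m : ℝ) ≤ n * L / 2) (hH : 4 * L ^ 2 ≤ H) :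
    ((n - t : ℕ) : ℝ) * ((m : ℝ) / (((n - t : ℕ) : ℝ) - 1 + m)) ^ (H + 1) ≤ 1 / 2 := by
  rw [Nat.cast_sub htn]
  have hn2 : (2 : ℝ) ≤ n := by
    rw [← hn]
    have := Real.add_one_le_exp L
    linarith
  have hN : (n : ℝ) / 2 ≤ (n : ℝ) - t - 1 := by linarith
  have hm0 : (0 : ℝ) ≤ m := Nat.cast_nonneg m
  have hpos : 0 < (n : ℝ) - t - 1 + m := by linarith
  have hbase : (m : ℝ) / ((n : ℝ) - t - 1 + m) ≤ Real.exp (-(1 / (2 * L))) := by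
    have e : (m : ℝ) / ((n : ℝ) - t - 1 + m) =
        1 - ((n : ℝ) - t - 1) / ((n : ℝ) - t - 1 + m) := by field_simp; ring
    rw [e]
    refine le_trans ?_ (Real.one_sub_le_exp_neg _)
    have : 1 / (2 * L) ≤ ((n : ℝ) - t - 1) / ((n : ℝ) - t - 1 + m) := by
      rw [div_le_div_iff₀ (by positivity) hpos]
      nlinarith
    linarith
  have hpow : ((m : ℝ) / ((n : ℝ) - t - 1 + m)) ^ (H + 1) ≤ Real.exp (-(2 * L)) := by
    refine (pow_le_pow_left₀ (by positivity) hbase _).trans ?_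
    rw [← Real.exp_nat_mul]
    apply Real.exp_le_exp.2
    have : 2 * L ≤ (H + 1 : ℕ) * (1 / (2 * L)) := by
      rw [mul_one_div, le_div_iff₀ (by positivity)]
      push_cast
      nlinarith
    linarith
  have ht0 : (0 : ℝ) ≤ t := Nat.cast_nonneg t
  calc _ ≤ (n : ℝ) * Real.exp (-(2 * L)) :=
        mul_le_mul (by linarith) hpow (by positivity) (by positivity)
    _ = 1 / n := by
        rw [show -(2 * L) = -L + -L by ring, Real.exp_add, Real.exp_neg, hn]
        field_simp
    _ ≤ 1 / 2 := one_div_le_one_div_of_le (by norm_num) hn2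

end LowerBound

/-! ### Comparing the two counts -/

section Main

/-- A lower bound for the number of diagrams with `m` crossings. -/
theorem le_card_crossings {n m : ℕ} {L : ℝ} (hn : Real.exp L = n) (hL : 144 ≤ L)
    (hbig : 10 ^ 10 * L ^ 32 ≤ n) (hnm : n ≤ m)
    (hm : (m : ℝ) ≤ 2 / Real.pi ^ 2 * n * L) :
    (n.multichoose m : ℝ) * 4 ^ n / (n ^ 3 * √n) ≤
      Nat.card {D : ChordDiagram n // D.crossings = m} := by
  have hL1 : 1 ≤ L := by linarith
  have hpow : ∀ k ≤ 32, L ^ k ≤ L ^ 32 := fun k hk => pow_le_pow_right₀ hL1 hk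
  have hnr : (0 : ℝ) < n := by rw [← hn]; exact Real.exp_pos L
  have hmr : (0 : ℝ) < m := hnr.trans_le (by exact_mod_cast hnm)
  have hpi : (9 : ℝ) ≤ Real.pi ^ 2 := by nlinarith [Real.pi_gt_three]
  have hmn : (m : ℝ) / n * Real.pi ^ 2 ≤ 2 * L := by
    rw [div_mul_eq_mul_div, div_le_iff₀ hnr]
    calc (m : ℝ) * Real.pi ^ 2 ≤ 2 / Real.pi ^ 2 * n * L * Real.pi ^ 2 :=
          mul_le_mul_of_nonneg_right hm (by positivity)
      _ = _ := by field_simp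
  -- `H` is large enough that parts above it are rare, and `s` large enough that a path rarely stays
  -- below `H`: `2L * 2(H+1)² ≤ 144 L^5 ≤ L^6 ≤ s`, whence `144 ≤ L`.
  set H := ⌈4 * L ^ 2⌉₊
  set s := ⌈L ^ 6⌉₊
  have hH : 4 * L ^ 2 ≤ H := Nat.le_ceil _
  have hH' : (H : ℝ) + 1 ≤ 6 * L ^ 2 := by
    have := Nat.ceil_lt_add_one (show 0 ≤ 4 * L ^ 2 by positivity)
    nlinarith
  have hs : L ^ 6 ≤ s := Nat.le_ceil _
  have hs' : (s : ℝ) + 1 ≤ 3 * L ^ 6 := by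
    have := Nat.ceil_lt_add_one (show 0 ≤ L ^ 6 by positivity)
    have h1 : 1 ≤ L ^ 6 := one_le_pow₀ hL1
    linarith
  set q : ℝ := (m : ℝ) / (m + n) with hq
  have hq0 : 0 < q := by positivity
  have hq1 : q < 1 := (div_lt_one (by positivity)).2 (by linarith)
  have hqq : q / (1 - q) = m / n := by
    have h0 : (m : ℝ) + n ≠ 0 := by positivity
    have h1 : 1 - q = n / (m + n) := by
      rw [hq, eq_div_iff h0, sub_mul, div_mul_cancel₀ _ h0]
      ring
    rw [h1, hq, div_div_div_cancel_right₀ h0]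
  obtain ⟨t, hts, hX⟩ := exists_transfer_ge hq0 hq1 H s (by
    have e1 : Real.exp (q / (1 - q) * (Real.pi ^ 2 / 6)) ≤ Real.exp L := by
      apply Real.exp_le_exp.2
      rw [hqq]
      linarith
    have e2 : Real.exp (-((s : ℝ) / (2 * (H + 1) ^ 2))) ≤ Real.exp (-(2 * L)) := by
      apply Real.exp_le_exp.2
      apply neg_le_neg
      rw [le_div_iff₀ (by positivity)]
      have : ((H : ℝ) + 1) ^ 2 ≤ (6 * L ^ 2) ^ 2 := pow_le_pow_left₀ (by positivity) hH' 2
      calc _ ≤ 2 * L * (2 * (6 * L ^ 2) ^ 2) := by gcongr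
        _ = 144 * L ^ 5 := by ring
        _ ≤ L * L ^ 5 := by gcongr
        _ = L ^ 6 := by ring
        _ ≤ _ := hs
    calc _ ≤ 4 * (6 * L ^ 2) ^ 3 * Real.exp L * Real.exp (-(2 * L)) := by gcongr
      _ = 864 * L ^ 6 * Real.exp (-L) := by
        rw [mul_assoc, ← Real.exp_add]
        ring_nf
      _ ≤ 1 := by
        rw [Real.exp_neg, hn, ← div_eq_mul_inv, div_le_one hnr]
        have := hpow 6 (by norm_num)
        nlinarith)
  rw [hqq] at hX
  have htr : (t : ℝ) + 1 ≤ 3 * L ^ 6 := by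
    have : (t : ℝ) ≤ s := by exact_mod_cast hts
    linarith
  have ht0 : (0 : ℝ) ≤ t := Nat.cast_nonneg t
  have h6 := hpow 6 (by norm_num)
  have hL32 : 0 ≤ L ^ 32 := by positivity
  have htn : 2 * ((t : ℝ) + 1) ≤ n := by linarith
  have htn' : t + 2 ≤ n := by
    have h0 : 2 * (t + 1) ≤ n := by exact_mod_cast htn
    have h1 : (3 : ℝ) ≤ n := by
      have := Real.add_one_le_exp L
      linarith
    have h2 : 3 ≤ n := by exact_mod_cast h1
    omega
  have hD : ((2 * (t * (H + t)) : ℕ) : ℝ) ≤ 54 * L ^ 12 := by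
    push_cast
    have h8 : L ^ 8 ≤ L ^ 12 := pow_le_pow_right₀ hL1 (by norm_num)
    calc 2 * ((t : ℝ) * (H + t)) ≤ 2 * (3 * L ^ 6 * (6 * L ^ 2 + 3 * L ^ 6)) := by
          gcongr <;> linarith
      _ = 36 * L ^ 8 + 18 * L ^ 12 := by ring
      _ ≤ _ := by linarith
  have hnm' : (n : ℝ) ≤ m := by exact_mod_cast hnm
  have hDm : 2 * (t * (H + t)) ≤ m := by
    have h12 := hpow 12 (by norm_num)
    have : ((2 * (t * (H + t)) : ℕ) : ℝ) ≤ m := by linarith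
    exact_mod_cast this
  have hmain := le_card_of_coeff_bound (n - t) t H m q ((n.multichoose m : ℝ) / 8) hq1 hDm (by
    intro j hj
    have hjr : (j : ℝ) ≤ 54 * L ^ 12 := le_trans (by exact_mod_cast hj) hD
    refine multichoose_le_coeff (by omega) hnm ?_ ?_ (hj.trans hDm) (by omega) ?_
    · have h12 := hpow 12 (by norm_num)
      have : (t : ℝ) ^ 2 ≤ (3 * L ^ 6) ^ 2 := pow_le_pow_left₀ ht0 (by linarith) 2
      have e : (3 * L ^ 6) ^ 2 = 9 * L ^ 12 := by ring
      linarith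
    · have h24 := hpow 24 (by norm_num)
      have : (j : ℝ) ^ 2 ≤ (54 * L ^ 12) ^ 2 := pow_le_pow_left₀ (Nat.cast_nonneg j) hjr 2
      have e : (54 * L ^ 12) ^ 2 = 2916 * L ^ 24 := by ring
      linarith
    · refine tail_le_half hL1 hn htn (by omega) (hm.trans ?_) hH
      have : 2 / Real.pi ^ 2 ≤ 1 / 2 := by
        rw [div_le_div_iff₀ (by positivity) (by norm_num)]
        linarith
      calc _ ≤ 1 / 2 * (n : ℝ) * L := by gcongr
        _ = _ := by ring)
  rw [Nat.sub_add_cancel (by omega)] at hmain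
  refine le_trans ?_ hmain
  set N := n - t with hN
  have hNpos : 0 < N := by omega
  have hNr : (0 : ℝ) < N := by exact_mod_cast hNpos
  have hNn : (N : ℝ) ≤ n := by exact_mod_cast Nat.sub_le _ _
  have hn1 : (1 : ℝ) ≤ n := by linarith
  have hcat : (4 : ℝ) ^ N / (4 * n ^ 2) ≤ N.centralBinom / (N + 1) := by
    have h1 : (4 : ℝ) ^ N ≤ 2 * N * N.centralBinom := by
      exact_mod_cast Nat.four_pow_le_two_mul_self_mul_centralBinom N hNpos
    rw [div_le_div_iff₀ (by positivity) (by positivity)]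
    calc (4 : ℝ) ^ N * (N + 1) ≤ 2 * n * N.centralBinom * (2 * n) := by
          refine mul_le_mul (h1.trans ?_) (by linarith) (by positivity) (by positivity)
          gcongr
      _ = _ := by ring
  have hY : (4 : ℝ) ^ t / (n * (1296 * L ^ 16)) ≤ qPochhammer q H *
      ((transfer fun h => 1 - q ^ h)^[t] (Pi.single H 1) 0) ^ 2 := by
    refine le_trans ?_ hX
    -- The bound on `m` enters here sharply: `(m/n) * π²/2 ≤ L`, so the cubed Pochhammer symbol
    -- costs only a factor `n`.
    have e1 : 1 / (n : ℝ) ≤ Real.exp (-((m : ℝ) / n * (Real.pi ^ 2 / 2))) := by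
      rw [← hn, one_div, ← Real.exp_neg, hn]
      apply Real.exp_le_exp.2
      linarith
    have e2 : 4 * ((H : ℝ) + 1) ^ 2 * (s + 1) ^ 2 ≤ 1296 * L ^ 16 := by
      calc _ ≤ 4 * (6 * L ^ 2) ^ 2 * (3 * L ^ 6) ^ 2 := by gcongr
        _ = _ := by ring
    calc _ = 4 ^ t * (1 / (n : ℝ)) / (1296 * L ^ 16) := by field_simp
      _ ≤ _ := by gcongr
  -- The constant is `8 * 4 * 1296`, from the coefficient, Catalan and outer-path bounds.
  have hsqrt : 41472 * L ^ 16 ≤ √n := by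
    apply Real.le_sqrt_of_sq_le
    have h1 : (41472 * L ^ 16) ^ 2 = 1719926784 * L ^ 32 := by ring
    linarith
  have h4 : (4 : ℝ) ^ n = 4 ^ N * 4 ^ t := by
    rw [← pow_add, hN, Nat.sub_add_cancel (by omega)]
  calc _ ≤ (n.multichoose m : ℝ) * 4 ^ n / (n ^ 3 * (41472 * L ^ 16)) := by gcongr
    _ = (n.multichoose m : ℝ) / 8 * (4 ^ N / (4 * n ^ 2)) * (4 ^ t / (n * (1296 * L ^ 16))) := by
      rw [h4]
      field_simp
      ring
    _ ≤ _ := by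
      refine mul_le_mul (mul_le_mul_of_nonneg_left hcat (by positivity)) hY (by positivity)
        (by positivity)

/-- The contribution of the components with `k` chords. -/
theorem sum_component_bound {n m k : ℕ} {α : ℝ} (hα : 2 ≤ α) (hk : 0 < k) (hkn : k ≤ n)
    (hmn : α * n ≤ m) :
    (4 : ℝ) ^ k * ∑ l ∈ Finset.range (⌊k * (m / (α * n))⌋₊ + 1),
      (k.multichoose l : ℝ) * ((n - k).multichoose (m - l) : ℝ) ≤
    n.multichoose m * (4 * Real.exp 1 ^ 2 / α) ^ k := by
  have hα0 : 0 < α := by linarith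
  have hnr : (0 : ℝ) < n := by exact_mod_cast hk.trans_le hkn
  have hkr : (0 : ℝ) < k := by exact_mod_cast hk
  have hmr : (0 : ℝ) < m := lt_of_lt_of_le (by positivity) hmn
  have hm0 : 0 < m := by exact_mod_cast hmr
  set x := ⌊(k : ℝ) * (m / (α * n))⌋₊
  have hx : (x : ℝ) ≤ k * (m / (α * n)) := Nat.floor_le (by positivity)
  have hxm : x < m := by
    have h1 : (k : ℝ) * (m / (α * n)) < m := by
      rw [← mul_div_assoc, div_lt_iff₀ (by positivity)]
      have : (k : ℝ) ≤ n := by exact_mod_cast hkn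
      have h2 : (k : ℝ) < α * n := by nlinarith
      calc (k : ℝ) * m < α * n * m := mul_lt_mul_of_pos_right h2 hmr
        _ = _ := mul_comm _ _
    exact_mod_cast hx.trans_lt h1
  have h1 : ∑ l ∈ Finset.range (x + 1),
      (k.multichoose l : ℝ) * ((n - k).multichoose (m - l) : ℝ) ≤
      ((k + 1).multichoose x : ℝ) * ((n - k).multichoose m : ℝ) := by
    rw [← sum_multichoose, Nat.cast_sum, Finset.sum_mul]
    refine Finset.sum_le_sum fun l hl => mul_le_mul_of_nonneg_left ?_ (Nat.cast_nonneg _)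
    have hlx := Nat.lt_succ_iff.1 (Finset.mem_range.1 hl)
    -- Monotonicity in the sum fails with no parts, where `multichoose 0 0 = 1`; but `l < m`, so the
    -- left side is then zero.
    rcases Nat.eq_zero_or_pos (n - k) with h0 | h0
    · obtain ⟨y, hy⟩ : ∃ y, m - l = y + 1 := ⟨m - l - 1, by omega⟩
      rw [h0, hy, Nat.multichoose_zero_succ]
      simp
    · exact_mod_cast multichoose_mono_right h0 (Nat.sub_le m l)
  have h2 := multichoose_succ_le k x hk
  have h3 := multichoose_sub_left_le n m k hkn hm0
  -- Since `αn ≤ m`, the product of the two fractions is at most `2/α`, and `2 ≤ e` turns `8e/α`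
  -- into `4e²/α`.
  have hratio : 4 * (Real.exp 1 * (((x : ℝ) + k) / k)) * ((n : ℝ) / (m + n)) ≤
      4 * Real.exp 1 ^ 2 / α := by
    have he : (2 : ℝ) ≤ Real.exp 1 := by
      have := Real.add_one_le_exp (1 : ℝ)
      linarith
    have e1 : ((x : ℝ) + k) / k ≤ m / (α * n) + 1 := by
      rw [div_le_iff₀ hkr]
      linarith
    have e2 : ((m : ℝ) / (α * n) + 1) * (n / (m + n)) ≤ 2 / α := by
      have : ((m : ℝ) / (α * n) + 1) * (n / (m + n)) = (m + α * n) / (α * (m + n)) := by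
        field_simp
      rw [this, div_le_div_iff₀ (by positivity) hα0]
      nlinarith [mul_pos hα0 hnr]
    calc _ = 4 * Real.exp 1 * ((((x : ℝ) + k) / k) * ((n : ℝ) / (m + n))) := by ring
      _ ≤ 4 * Real.exp 1 * ((m / (α * n) + 1) * ((n : ℝ) / (m + n))) := by gcongr
      _ ≤ 4 * Real.exp 1 * (2 / α) := by gcongr
      _ ≤ 4 * Real.exp 1 * (Real.exp 1 / α) := by gcongr
      _ = _ := by ring
  calc _ ≤ (4 : ℝ) ^ k * ((Real.exp 1 * (((x : ℝ) + k) / k)) ^ k *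
        (n.multichoose m * ((n : ℝ) / (m + n)) ^ k)) := by
        refine mul_le_mul_of_nonneg_left (h1.trans ?_) (by positivity)
        exact mul_le_mul h2 h3 (by positivity) (by positivity)
    _ = n.multichoose m * (4 * (Real.exp 1 * (((x : ℝ) + k) / k)) * ((n : ℝ) / (m + n))) ^ k := by
        generalize ((x : ℝ) + k) / k = y
        generalize (n : ℝ) / (m + n) = z
        ring
    _ ≤ _ := by gcongr

open ChordDiagram in
/-- The number of diagrams with a large sparse component. -/
theorem card_sparse_le {n m : ℕ} {α x : ℝ} (hα : 2 ≤ α) (hx : 0 ≤ x) (hn : 0 < n)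
    (hr : 4 * Real.exp 1 ^ 2 / α < 1) (hmn : α * n ≤ m) :
    (Nat.card {D : ChordDiagram n // D.crossings = m ∧
      ∃ K : D.intersectionGraph.ConnectedComponent, x < (D.componentSize K : ℝ) ∧
        D.componentDensity K < (m : ℝ) / (α * n)} : ℝ) ≤
    (2 * n + 1) * 4 ^ n * n.multichoose m *
      ((4 * Real.exp 1 ^ 2 / α) ^ (⌊x⌋₊ + 1) / (1 - 4 * Real.exp 1 ^ 2 / α)) := by
  classical
  have : Fintype (ChordDiagram n) := Fintype.ofFinite _
  set r := 4 * Real.exp 1 ^ 2 / α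
  have hr0 : 0 < r := by positivity
  have hnr : (0 : ℝ) < n := by exact_mod_cast hn
  let T : ℕ → ℕ → Finset (ChordDiagram n) := fun k l => Finset.univ.filter fun D =>
    D.crossings = m ∧ ∃ K, D.componentSize K = k ∧ D.componentCrossings K = l
  have hT : ∀ k l, (T k l).card ≤
      (2 * n + 1) * 4 ^ n * 4 ^ k * (k.multichoose l * (n - k).multichoose (m - l)) := by
    intro k l
    rw [← Fintype.card_subtype, ← Nat.card_eq_fintype_card]
    exact card_component_le n m k l
  have hcover : Nat.card {D : ChordDiagram n // D.crossings = m ∧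
      ∃ K : D.intersectionGraph.ConnectedComponent, x < (D.componentSize K : ℝ) ∧
        D.componentDensity K < (m : ℝ) / (α * n)} ≤
      ∑ k ∈ Finset.Ico (⌊x⌋₊ + 1) (n + 1), ∑ l ∈ Finset.range (⌊(k : ℝ) * (m / (α * n))⌋₊ + 1),
        (T k l).card := by
    rw [Nat.card_eq_fintype_card, Fintype.card_subtype]
    refine le_trans ?_ (Finset.card_biUnion_le.trans
      (Finset.sum_le_sum fun k _ => Finset.card_biUnion_le))
    refine Finset.card_le_card fun D hD => ?_
    obtain ⟨hDm, K, hK1, hK2⟩ := (Finset.mem_filter.1 hD).2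
    refine Finset.mem_biUnion.2 ⟨D.componentSize K, ?_, Finset.mem_biUnion.2
      ⟨D.componentCrossings K, ?_, Finset.mem_filter.2 ⟨Finset.mem_univ _, hDm, K, rfl, rfl⟩⟩⟩
    · rw [Finset.mem_Ico]
      refine ⟨(Nat.floor_lt hx).2 hK1, Nat.lt_succ_iff.2 ?_⟩
      rw [← card_points_inter_closers]
      exact (Finset.card_le_card Finset.inter_subset_right).trans D.card_closers.le
    · rw [Finset.mem_range, Nat.lt_succ_iff]
      apply Nat.le_floor
      rw [componentDensity, div_lt_iff₀ (hx.trans_lt hK1)] at hK2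
      rw [mul_comm]
      exact hK2.le
  have hgeom : ∑ k ∈ Finset.Ico (⌊x⌋₊ + 1) (n + 1), r ^ k ≤ r ^ (⌊x⌋₊ + 1) / (1 - r) :=
    geom_sum_Ico_le_of_lt_one hr0.le hr
  calc _ ≤ ∑ k ∈ Finset.Ico (⌊x⌋₊ + 1) (n + 1),
        ∑ l ∈ Finset.range (⌊(k : ℝ) * (m / (α * n))⌋₊ + 1), ((T k l).card : ℝ) := by
        exact_mod_cast hcover
    _ ≤ ∑ k ∈ Finset.Ico (⌊x⌋₊ + 1) (n + 1),
        (2 * n + 1) * 4 ^ n * (n.multichoose m * r ^ k) := by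
        refine Finset.sum_le_sum fun k hk => ?_
        obtain ⟨hk1, hk2⟩ := Finset.mem_Ico.1 hk
        have hb := sum_component_bound hα (Nat.pos_of_ne_zero (by omega)) (Nat.lt_succ_iff.1 hk2) hmn
        calc _ ≤ ∑ l ∈ Finset.range (⌊(k : ℝ) * (m / (α * n))⌋₊ + 1), ((2 * n + 1) * 4 ^ n * 4 ^ k *
              ((k.multichoose l : ℝ) * ((n - k).multichoose (m - l) : ℝ))) := by
              refine Finset.sum_le_sum fun l _ => ?_
              exact_mod_cast hT k l
          _ = (2 * n + 1) * 4 ^ n * (4 ^ k * ∑ l ∈ Finset.range (⌊(k : ℝ) * (m / (α * n))⌋₊ + 1),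
              ((k.multichoose l : ℝ) * ((n - k).multichoose (m - l) : ℝ))) := by
              rw [← Finset.mul_sum]
              ring
          _ ≤ _ := mul_le_mul_of_nonneg_left hb (by positivity)
    _ = (2 * n + 1) * 4 ^ n * n.multichoose m *
        ∑ k ∈ Finset.Ico (⌊x⌋₊ + 1) (n + 1), r ^ k := by
        rw [Finset.mul_sum]
        exact Finset.sum_congr rfl fun k _ => by ring
    _ ≤ _ := mul_le_mul_of_nonneg_left hgeom (by positivity)

/-- Positivity matters: for an empty class the left side is `0` by convention and the right side is
`1`. -/
theorem ChordDiagram.uniformProb_not {n m : ℕ} (P : ChordDiagram n → Prop)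
    (h : 0 < Nat.card {D : ChordDiagram n // D.crossings = m}) :
    uniformProb n m (fun D => ¬ P D) = 1 - (Nat.card {D : ChordDiagram n // D.crossings = m ∧ P D} : ℝ) /
      Nat.card {D : ChordDiagram n // D.crossings = m} := by
  classical
  have : Fintype (ChordDiagram n) := Fintype.ofFinite _
  have h' : (Nat.card {D : ChordDiagram n // D.crossings = m} : ℝ) ≠ 0 := by
    exact_mod_cast h.ne'
  rw [uniformProb, eq_sub_iff_add_eq, ← add_div, div_eq_one_iff_eq h']
  norm_cast
  simp only [Nat.card_eq_fintype_card, Fintype.card_subtype]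
  rw [add_comm, ← Finset.filter_filter, ← Finset.filter_filter, Finset.card_filter_add_card_filter_not]

theorem mainTheorem12 (α β : ℝ) (hα : 4 * Real.exp 1 ^ 2 < α)
    (hβ : β = 5 / (Real.log α - Real.log (4 * Real.exp 1 ^ 2)))
    (m : ℕ → ℕ) (hdens : ∀ᶠ n : ℕ in atTop, α < (m n : ℝ) / (n : ℝ))
    (ω : ℕ → ℝ) (hω : Tendsto ω atTop atTop)
    (hm : ∀ᶠ n : ℕ in atTop, (m n : ℝ) ≤ 2 / Real.pi ^ 2 * (n : ℝ) *
      (Real.log (n : ℝ) - 3 / 2 * Real.log (Real.log (n : ℝ)) - ω n)) :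
    Tendsto (fun n : ℕ => ChordDiagram.uniformProb n (m n) fun D =>
        ¬ ∃ K : D.intersectionGraph.ConnectedComponent,
          β * Real.log (n : ℝ) < (D.componentSize K : ℝ) ∧
          D.componentDensity K < (m n : ℝ) / (α * (n : ℝ)))
      atTop (𝓝 1) := by
  have he : (2 : ℝ) ≤ Real.exp 1 := by
    have := Real.add_one_le_exp (1 : ℝ)
    linarith
  have hα2 : 2 ≤ α := by nlinarith
  have hα0 : 0 < α := by linarith
  set r := 4 * Real.exp 1 ^ 2 / α with hr
  have hr0 : 0 < r := by positivity
  have hr1 : r < 1 := (div_lt_one hα0).2 hα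
  have hlogr : Real.log r = Real.log (4 * Real.exp 1 ^ 2) - Real.log α :=
    Real.log_div (by positivity) hα0.ne'
  have hlogneg : Real.log r < 0 := Real.log_neg hr0 hr1
  have hβr : β * Real.log r = -5 := by
    rw [hβ, ← neg_sub (Real.log (4 * Real.exp 1 ^ 2)), ← hlogr, div_neg, neg_mul,
      div_mul_cancel₀ _ hlogneg.ne]
  have hβ0 : 0 < β := by
    by_contra h
    nlinarith [mul_nonneg_of_nonpos_of_nonpos (not_lt.1 h) hlogneg.le]
  have hcast : Tendsto (fun n : ℕ => (n : ℝ)) atTop atTop := tendsto_natCast_atTop_atTop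
  have hlog : Tendsto (fun n : ℕ => Real.log (n : ℝ)) atTop atTop :=
    Real.tendsto_log_atTop.comp hcast
  have hbig : ∀ᶠ n : ℕ in atTop, 10 ^ 10 * Real.log (n : ℝ) ^ 32 ≤ (n : ℝ) := by
    have h1 := (Real.isLittleO_pow_log_id_atTop (n := 32)).comp_tendsto hcast
    have h2 := h1.def (c := 1 / 10 ^ 10) (by norm_num)
    filter_upwards [h2, hlog.eventually_ge_atTop 0] with n hn hl
    simp only [Function.comp_apply, id, Real.norm_eq_abs, Nat.abs_cast] at hn
    rw [abs_of_nonneg (by positivity)] at hn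
    linarith
  have hlim : Tendsto (fun n : ℕ => 1 - 3 / (1 - r) / √(n : ℝ)) atTop (𝓝 1) := by
    have h1 : Tendsto (fun n : ℕ => √(n : ℝ)) atTop atTop := Real.tendsto_sqrt_atTop.comp hcast
    simpa using (h1.const_div_atTop (3 / (1 - r))).const_sub 1
  have hkey : ∀ᶠ n : ℕ in atTop,
      1 - 3 / (1 - r) / √(n : ℝ) ≤ ChordDiagram.uniformProb n (m n) (fun D =>
        ¬ ∃ K : D.intersectionGraph.ConnectedComponent,
          β * Real.log (n : ℝ) < (D.componentSize K : ℝ) ∧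
          D.componentDensity K < (m n : ℝ) / (α * (n : ℝ))) ∧
      ChordDiagram.uniformProb n (m n) (fun D =>
        ¬ ∃ K : D.intersectionGraph.ConnectedComponent,
          β * Real.log (n : ℝ) < (D.componentSize K : ℝ) ∧
          D.componentDensity K < (m n : ℝ) / (α * (n : ℝ))) ≤ 1 := by
    filter_upwards [hdens, hm, hbig, hlog.eventually_ge_atTop 144, hω.eventually_ge_atTop 0,
      eventually_gt_atTop 0] with n hd hmn hb hL hωn hn
    have hnr : (0 : ℝ) < n := by exact_mod_cast hn
    have hn1 : (1 : ℝ) ≤ n := by exact_mod_cast hn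
    set L := Real.log (n : ℝ)
    have hexp : Real.exp L = n := Real.exp_log hnr
    have hmα : α * n ≤ m n := ((lt_div_iff₀ hnr).1 hd).le
    have hnm : n ≤ m n := by
      have : (n : ℝ) ≤ m n := by nlinarith
      exact_mod_cast this
    have hmL : (m n : ℝ) ≤ 2 / Real.pi ^ 2 * n * L := by
      refine hmn.trans (mul_le_mul_of_nonneg_left ?_ (by positivity))
      have : 0 ≤ Real.log L := Real.log_nonneg (by linarith)
      linarith
    have hlow := le_card_crossings hexp hL hb hnm hmL
    have hup := card_sparse_le (x := β * L) hα2 (by positivity) hn hr1 hmα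
    have hMpos : (0 : ℝ) < n.multichoose (m n) := by
      have h1 := multichoose_mono_right (N := n) hn (Nat.zero_le (m n))
      rw [Nat.multichoose_zero_right] at h1
      exact_mod_cast h1
    have hIpos : (0 : ℝ) < Nat.card {D : ChordDiagram n // D.crossings = m n} :=
      lt_of_lt_of_le (by positivity) hlow
    rw [ChordDiagram.uniformProb_not _ (by exact_mod_cast hIpos)]
    refine ⟨sub_le_sub_left ?_ 1, sub_le_self _ (by positivity)⟩
    -- The `5` in `β` is chosen for this: one power of `n` pays for the position of the component
    -- and `7/2` for the lower bound, leaving `√n` to spare.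
    have hrk : r ^ (⌊β * L⌋₊ + 1) ≤ 1 / (n : ℝ) ^ 5 := by
      have h1 : r ^ (⌊β * L⌋₊ + 1) = Real.exp (((⌊β * L⌋₊ + 1 : ℕ) : ℝ) * Real.log r) := by
        rw [Real.exp_nat_mul, Real.exp_log hr0]
      rw [h1, ← hexp, ← Real.exp_nat_mul, one_div, ← Real.exp_neg]
      apply Real.exp_le_exp.2
      have h2 : β * L ≤ ((⌊β * L⌋₊ + 1 : ℕ) : ℝ) := by
        push_cast
        exact (Nat.lt_floor_add_one _).le
      have h3 := mul_le_mul_of_nonpos_right h2 hlogneg.le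
      have h4 : β * L * Real.log r = -5 * L := by rw [mul_right_comm, hβr]
      push_cast at h3 ⊢
      linarith
    have h1r : 0 < 1 - r := by linarith
    rw [div_le_iff₀ hIpos]
    refine hup.trans ?_
    refine le_trans ?_ (mul_le_mul_of_nonneg_left hlow (by positivity))
    have hsq : √(n : ℝ) * √(n : ℝ) = n := Real.mul_self_sqrt hnr.le
    calc _ ≤ (3 * (n : ℝ)) * 4 ^ n * n.multichoose (m n) * (1 / (n : ℝ) ^ 5 / (1 - r)) := by
          gcongr
          linarith
      _ = 3 / (1 - r) * (n.multichoose (m n) * 4 ^ n / (n ^ 3 * n)) := by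
          field_simp
      _ = 3 / (1 - r) / √(n : ℝ) * (n.multichoose (m n) * 4 ^ n / (n ^ 3 * √(n : ℝ))) := by
          have hs0 : 0 < √(n : ℝ) := Real.sqrt_pos.2 hnr
          rw [show (n : ℝ) ^ 3 * n = n ^ 3 * (√(n : ℝ) * √(n : ℝ)) by rw [hsq]]
          field_simp
  exact tendsto_of_tendsto_of_tendsto_of_le_of_le' hlim tendsto_const_nhds
    (hkey.mono fun _ h => h.1) (hkey.mono fun _ h => h.2)

end Main
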